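/- Let $(\omega_x)_{x\in\mathbb Z^2}$ be independent rate-$1$ exponential random variables on a probability space. For $x\in\mathbb Z_{\ge 0}^2$ let $$G_{0,x}=\max_{x_\bullet}\sum_{k=0}^{|x|_1}\omega_{x_k},$$ where the maximum is over all lattice paths $x_\bullet=(x_k)_{k=0}^{|x|_1}$ from $x_0=0$ to $x_{|x|_1}=x$ with increments $x_{k+1}-x_k\in\{(1,0),(0,1)\}$, and $|x|_1=|x_1|+|x_2|$. For $\xi\in\mathbb R_{\ge0}^2$ let $g_{\rm pp}(\xi)=(\sqrt{\xi_1}+\sqrt{\xi_2}\,)^2$; for real $t$ let $A_t=\{\zeta\in\mathbb R_{\ge0}^2: G_{0,\lfloor\zeta\rfloor}\le t\}$, with $\lfloor\cdot\rfloor$ taken coordinatewise, and let $\mathcal A=\{\zeta\in\mathbb R_{\ge0}^2: g_{\rm pp}(\zeta)\le 1\}$. Then the following hold. (0) (Law of large numbers.) The function $g_{\rm pp}$ is the shape function of the model: for each $\xi\in\mathbb R_{\ge0}^2$, almost surely $N^{-1}G_{0,\lfloor N\xi\rfloor}\to g_{\rm pp}(\xi)$ as $N\to\infty$. (1) (Uniform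 law of large numbers.) For every $\varepsilon>0$ there is an almost surely finite random variable $K$ such that, almost surely, $|G_{0,x}-g_{\rm pp}(x)|\le\varepsilon|x|_1$ for all $x\in\mathbb Z_{\ge0}^2$ with $|x|_1\ge K$. (2) (Shape theorem.) For every $\varepsilon>0$ there is an almost surely finite random variable $T$ such that, almost surely, $$t(1-\varepsilon)\mathcal A\subset A_t\subset t(1+\varepsilon)\mathcal A\qquad\text{for all real } t\ge T,$$ where for $\varepsilon>1$ only the second inclusion is asserted. -/

import Mathlib

open MeasureTheory ProbabilityTheory Filter Topology
open scoped Pointwise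

namespace CornerGrowth

/-- The `ℓ¹` norm `|z|₁ = |z₁| + |z₂|` of a lattice point, as a natural number. -/
def l1 (z : ℤ × ℤ) : ℕ := z.1.natAbs + z.2.natAbs

/-- Admissible (up-right) lattice paths `(x₀, …, xₙ)`, `n = |y - x|₁`, from `x₀ = x` to `xₙ = y`,
with increments in `{e₁, e₂}`. -/
def IsUpRightPath (x y : ℤ × ℤ) (p : Fin (l1 (y - x) + 1) → ℤ × ℤ) : Prop :=
  p 0 = x ∧ p (Fin.last _) = y ∧
    ∀ k : Fin (l1 (y - x)),
      p k.succ = p k.castSucc + (1, 0) ∨ p k.succ = p k.castSucc + (0, 1)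

/-- The weights collected by the admissible paths from `x` to `y` (both endpoints included). -/
def passageWeights (w : ℤ × ℤ → ℝ) (x y : ℤ × ℤ) : Set ℝ :=
  {s | ∃ p : Fin (l1 (y - x) + 1) → ℤ × ℤ, IsUpRightPath x y p ∧ s = ∑ k, w (p k)}

/-- The last-passage value `G_{x,y}`, for `x ≤ y` coordinatewise. The supremum is a maximum over
a finite nonempty set, see `isGreatest_lastPassage`. It is not used when `x ≤ y` fails. -/
noncomputable def lastPassage (w : ℤ × ℤ → ℝ) (x y : ℤ × ℤ) : ℝ :=
  sSup (passageWeights w x y)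

/-- The shape function `g_pp(ξ) = (√ξ₁ + √ξ₂)²` on the closed first quadrant. -/
noncomputable def gpp (ξ : ℝ × ℝ) : ℝ := (√ξ.1 + √ξ.2) ^ 2

/-- Coordinatewise integer part. -/
noncomputable def floorPt (ζ : ℝ × ℝ) : ℤ × ℤ := (⌊ζ.1⌋, ⌊ζ.2⌋)

/-- The growing cluster `A_t = {ζ ∈ ℝ²_{≥0} : G_{0,⌊ζ⌋} ≤ t}`. -/
def cluster (w : ℤ × ℤ → ℝ) (t : ℝ) : Set (ℝ × ℝ) :=
  {ζ | 0 ≤ ζ.1 ∧ 0 ≤ ζ.2 ∧ lastPassage w 0 (floorPt ζ) ≤ t}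

/-- The limit shape `𝒜 = {ζ ∈ ℝ²_{≥0} : g_pp(ζ) ≤ 1}`. -/
def limitShape : Set (ℝ × ℝ) :=
  {ζ | 0 ≤ ζ.1 ∧ 0 ≤ ζ.2 ∧ gpp ζ ≤ 1}

theorem finite_passageWeights (w : ℤ × ℤ → ℝ) (x y : ℤ × ℤ) :
    (passageWeights w x y).Finite := by
  have hfin : {p : Fin (l1 (y - x) + 1) → ℤ × ℤ | IsUpRightPath x y p}.Finite := by
    refine (Set.Finite.pi' (t := fun k : Fin (l1 (y - x) + 1) =>
      Set.Icc x (x + ((k : ℕ) : ℤ × ℤ))) fun k => Set.finite_Icc _ _).subset ?_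
    rintro p ⟨h0, -, hs⟩ k
    induction k using Fin.induction with
    | zero => simp [h0]
    | succ k ih =>
      obtain ⟨⟨a1, a2⟩, ⟨b1, b2⟩⟩ := ih
      simp at a1 a2 b1 b2
      rcases hs k with h | h <;> rw [h] <;> refine ⟨⟨?_, ?_⟩, ⟨?_, ?_⟩⟩ <;> simp <;> omega
  refine (hfin.image fun p => ∑ k, w (p k)).subset ?_
  rintro s ⟨p, hp, rfl⟩
  exact ⟨p, hp, rfl⟩

theorem nonempty_passageWeights (w : ℤ × ℤ → ℝ) {x y : ℤ × ℤ} (h : x ≤ y) :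
    (passageWeights w x y).Nonempty := by
  obtain ⟨h1, h2⟩ := h
  refine ⟨_, fun k => x + (min (k : ℤ) (y.1 - x.1), (k : ℤ) - min (k : ℤ) (y.1 - x.1)),
    ⟨?_, ?_, ?_⟩, rfl⟩
  · ext <;> simp <;> omega
  · have e1 : |y.1 - x.1| = y.1 - x.1 := abs_of_nonneg (by omega)
    have e2 : |y.2 - x.2| = y.2 - x.2 := abs_of_nonneg (by omega)
    ext <;> simp [l1, e1, e2] <;> omega
  · intro k
    simp only [Prod.ext_iff, Fin.val_succ, Fin.val_castSucc, Prod.fst_add, Prod.snd_add]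
    push_cast
    omega

theorem isGreatest_lastPassage (w : ℤ × ℤ → ℝ) {x y : ℤ × ℤ} (h : x ≤ y) :
    IsGreatest (passageWeights w x y) (lastPassage w x y) :=
  ⟨(nonempty_passageWeights w h).csSup_mem (finite_passageWeights w x y),
    fun _ hs => le_csSup (finite_passageWeights w x y).bddAbove hs⟩

end CornerGrowth

/-! The model has a solvable stationary version: enlarge the weights on the axes, to rate `1 - ρ` on
the horizontal one (origin included) and rate `ρ` on the vertical one. Burke's property
(`measurePreserving_burkeMap`, `IsExpFamily.burke`) propagates the independence and the rates of the
increments through the recursion. Hence the stationary value at `(m, n)` is a sum of Exp(`1 - ρ`)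
variables along the bottom row plus a sum of Exp(`ρ`) variables up a column
(`exists_lpp_eq_sum_add_sum`). Chernoff bounds concentrate it exponentially around `m/(1 - ρ) +
n/ρ`. The minimum of this over `ρ` is `(√m + √n)²`, attained at the characteristic value `ρ = √n/(√m
+ √n)`.

Upper tail (`IsExpFamily.lpp_upper_tail`): enlarging weights can only raise passage values, so the
stationary model dominates the original one for every `ρ`; a nearly minimizing `ρ` gives the bound.

Lower tail (`IsExpFamily.lpp_lower_tail`): an optimal stationary path follows an axis for some
distance `k` and then uses original weights only. At the characteristic `ρ`, leaving at distance `k`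
costs an amount quadratic in `k` (`mul_add_gpp_le`). The upper tail bounds the part after the exit,
so `k` must be small compared with `m + n`; then the part after the exit, which is at most `G`,
carries almost the whole stationary value. Near the axes, a single row or column suffices.

Both tails are exponential in `m + n`, so they are summable over the quadrant and Borel–Cantelli
gives the uniform law. The other two claims follow deterministically, by continuity and homogeneity
of `gpp` and a comparison of `ζ` with `⌊ζ⌋`. -/

namespace CornerGrowth

/-! ### The recursion for last-passage values -/

/-- The last-passage value from the origin to `(i, j)`, by its recursion. -/
noncomputable def lpp (w : ℤ × ℤ → ℝ) : ℕ → ℕ → ℝ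
  | 0, 0 => w (0, 0)
  | i + 1, 0 => lpp w i 0 + w (i + 1, 0)
  | 0, j + 1 => lpp w 0 j + w (0, j + 1)
  | i + 1, j + 1 => max (lpp w i (j + 1)) (lpp w (i + 1) j) + w (i + 1, j + 1)
  termination_by i j => i + j

theorem lpp_zero_zero (w : ℤ × ℤ → ℝ) : lpp w 0 0 = w (0, 0) := by rw [lpp]

theorem lpp_succ_zero (w : ℤ × ℤ → ℝ) (i : ℕ) :
    lpp w (i + 1) 0 = lpp w i 0 + w (i + 1, 0) := by rw [lpp]

theorem lpp_zero_succ (w : ℤ × ℤ → ℝ) (j : ℕ) :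
    lpp w 0 (j + 1) = lpp w 0 j + w (0, j + 1) := by rw [lpp]

theorem lpp_succ_succ (w : ℤ × ℤ → ℝ) (i j : ℕ) :
    lpp w (i + 1) (j + 1) =
      max (lpp w i (j + 1)) (lpp w (i + 1) j) + w (i + 1, j + 1) := by rw [lpp]

/-- Induction along the recursion of `lpp`. -/
theorem grid_induction {p : ℕ → ℕ → Prop} (h00 : p 0 0) (h10 : ∀ i, p i 0 → p (i + 1) 0)
    (h01 : ∀ j, p 0 j → p 0 (j + 1))
    (h11 : ∀ i j, p i (j + 1) → p (i + 1) j → p (i + 1) (j + 1)) (i j : ℕ) : p i j := by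
  induction i generalizing j with
  | zero => induction j with
    | zero => exact h00
    | succ j ih => exact h01 j ih
  | succ i ihi => induction j with
    | zero => exact h10 i (ihi 0)
    | succ j ihj => exact h11 i j (ihi _) ihj

theorem lpp_add_le_right (w : ℤ × ℤ → ℝ) (i j : ℕ) :
    lpp w i j + w (i + 1, j) ≤ lpp w (i + 1) j := by
  cases j with
  | zero => simp [lpp_succ_zero]
  | succ j => rw [lpp_succ_succ]; push_cast; gcongr; exact le_max_left _ _

theorem lpp_add_le_up (w : ℤ × ℤ → ℝ) (i j : ℕ) :
    lpp w i j + w (i, j + 1) ≤ lpp w i (j + 1) := by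
  cases i with
  | zero => simp [lpp_zero_succ]
  | succ i => rw [lpp_succ_succ]; push_cast; gcongr; exact le_max_right _ _

theorem lpp_le_lpp {w w' : ℤ × ℤ → ℝ} (h : ∀ i j : ℕ, w (i, j) ≤ w' (i, j)) (i j : ℕ) :
    lpp w i j ≤ lpp w' i j := by
  induction i, j using grid_induction with
  | h00 => simpa [lpp_zero_zero] using h 0 0
  | h10 i ih => rw [lpp_succ_zero, lpp_succ_zero]; exact add_le_add ih (by simpa using h (i + 1) 0)
  | h01 j ih => rw [lpp_zero_succ, lpp_zero_succ]; exact add_le_add ih (by simpa using h 0 (j + 1))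
  | h11 i j ih1 ih2 =>
    rw [lpp_succ_succ, lpp_succ_succ]
    exact add_le_add (max_le_max ih1 ih2) (by simpa using h (i + 1) (j + 1))

theorem lpp_congr {w w' : ℤ × ℤ → ℝ} (h : ∀ i j : ℕ, w (i, j) = w' (i, j)) (i j : ℕ) :
    lpp w i j = lpp w' i j :=
  le_antisymm (lpp_le_lpp (fun i j => (h i j).le) i j) (lpp_le_lpp (fun i j => (h i j).ge) i j)

theorem lpp_mono {w : ℤ × ℤ → ℝ} (h : ∀ z, 0 ≤ w z) {i j i' j' : ℕ} (hi : i ≤ i')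
    (hj : j ≤ j') : lpp w i j ≤ lpp w i' j' := by
  have h1 : Monotone fun i => lpp w i j := monotone_nat_of_le_succ fun i =>
    (le_add_of_nonneg_right (h _)).trans (lpp_add_le_right w i j)
  have h2 : Monotone fun j => lpp w i' j := monotone_nat_of_le_succ fun j =>
    (le_add_of_nonneg_right (h _)).trans (lpp_add_le_up w i' j)
  exact (h1 hi).trans (h2 hj)

theorem lpp_swap (w : ℤ × ℤ → ℝ) (i j : ℕ) : lpp (fun z => w z.swap) i j = lpp w j i := by
  induction i, j using grid_induction with
  | h00 => simp [lpp_zero_zero]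
  | h10 i ih => simp [lpp_succ_zero, lpp_zero_succ, ih]
  | h01 j ih => simp [lpp_succ_zero, lpp_zero_succ, ih]
  | h11 i j ih1 ih2 => simp [lpp_succ_succ, ih1, ih2, max_comm]

/-- A path starting at `(1, 0)` can be prefixed by the origin, whose weight is nonnegative. -/
theorem lpp_shift_right_le {w : ℤ × ℤ → ℝ} (h : ∀ z, 0 ≤ w z) (i j : ℕ) :
    lpp (fun z => w (z + (1, 0))) i j ≤ lpp w (i + 1) j := by
  induction i, j using grid_induction with
  | h00 =>
    have h0 := h (0, 0)
    simp [lpp_zero_zero, lpp_succ_zero]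
    linarith
  | h10 i ih => rw [lpp_succ_zero, lpp_succ_zero]; simpa using ih
  | h01 j ih =>
    rw [lpp_succ_succ, lpp_zero_succ]
    simpa using Or.inr ih
  | h11 i j ih1 ih2 =>
    rw [lpp_succ_succ, lpp_succ_succ]
    simpa using max_le_max ih1 ih2

theorem lpp_shift_right_le' {w : ℤ × ℤ → ℝ} (h : ∀ z, 0 ≤ w z) (k i j : ℕ) :
    lpp (fun z => w (z + ((k : ℤ), 0))) i j ≤ lpp w (i + k) j := by
  induction k generalizing i with
  | zero => simp [show ((0, 0) : ℤ × ℤ) = 0 from rfl]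
  | succ k ih =>
    refine le_trans ?_ ((ih (i + 1)).trans (by rw [add_assoc, add_comm 1 k]))
    refine le_trans (le_of_eq ?_) (lpp_shift_right_le (fun z => h _) i j)
    congr 1
    ext z
    congr 1
    ext <;> simp
    ring

theorem lpp_shift_up_le {w : ℤ × ℤ → ℝ} (h : ∀ z, 0 ≤ w z) (k i j : ℕ) :
    lpp (fun z => w (z + (0, (k : ℤ)))) i j ≤ lpp w i (j + k) := by
  rw [← lpp_swap, ← lpp_swap w]
  exact lpp_shift_right_le' (w := fun z => w z.swap) (fun z => h _) k j i

/-- Every path to an interior point leaves one of the axes at a last point. -/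
theorem exists_exit_point (w : ℤ × ℤ → ℝ) (m n : ℕ) :
    (∃ k ≤ m, lpp w (m + 1) (n + 1) ≤
      lpp w (k + 1) 0 + lpp (fun z => w (z + ((k : ℤ) + 1, 1))) (m - k) n) ∨
    (∃ k ≤ n, lpp w (m + 1) (n + 1) ≤
      lpp w 0 (k + 1) + lpp (fun z => w (z + (1, (k : ℤ) + 1))) m (n - k)) := by
  have key : ∀ s m n : ℕ, m + n = s →
    (∃ k ≤ m, lpp w (m + 1) (n + 1) ≤
      lpp w (k + 1) 0 + lpp (fun z => w (z + ((k : ℤ) + 1, 1))) (m - k) n) ∨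
    (∃ k ≤ n, lpp w (m + 1) (n + 1) ≤
      lpp w 0 (k + 1) + lpp (fun z => w (z + (1, (k : ℤ) + 1))) m (n - k)) := by
    intro s
    induction s with
    | zero =>
      intro m n h
      obtain ⟨rfl, rfl⟩ : m = 0 ∧ n = 0 := by omega
      rw [lpp_succ_succ]
      rcases max_cases (lpp w 0 (0 + 1)) (lpp w (0 + 1) 0) with ⟨h, -⟩ | ⟨h, -⟩ <;> rw [h]
      · exact Or.inr ⟨0, le_rfl, by simp [lpp_zero_zero]⟩
      · exact Or.inl ⟨0, le_rfl, by simp [lpp_zero_zero]⟩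
    | succ s ih =>
      intro m n hs
      rw [lpp_succ_succ]
      -- Take the predecessor that realizes the maximum. If it lies on an axis, the exit happens at
      -- this very step; otherwise its own exit point serves, with the part after the exit prolonged
      -- by one step.
      rcases max_cases (lpp w m (n + 1)) (lpp w (m + 1) n) with ⟨h, -⟩ | ⟨h, -⟩ <;> rw [h]
      · rcases m with _ | m
        · exact Or.inr ⟨n, le_rfl, by simp [lpp_zero_zero]⟩
        · rcases ih m n (by omega) with ⟨k, hk, hle⟩ | ⟨k, hk, hle⟩
          · refine Or.inl ⟨k, by omega, ?_⟩
            have := lpp_add_le_right (fun z => w (z + ((k : ℤ) + 1, 1))) (m - k) n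
            have e : m + 1 - k = m - k + 1 := by omega
            rw [e]
            have e2 : ((((m - k : ℕ) : ℤ) + 1, (n : ℤ)) + ((k : ℤ) + 1, 1) : ℤ × ℤ)
              = (((m + 1 : ℕ) : ℤ) + 1, (n : ℤ) + 1) := by ext <;> simp; omega
            simp only [e2] at this
            linarith
          · refine Or.inr ⟨k, by omega, ?_⟩
            have := lpp_add_le_right (fun z => w (z + (1, (k : ℤ) + 1))) m (n - k)
            have e2 : (((m : ℤ) + 1, ((n - k : ℕ) : ℤ)) + (1, (k : ℤ) + 1) : ℤ × ℤ)
              = (((m + 1 : ℕ) : ℤ) + 1, (n : ℤ) + 1) := by ext <;> simp; omega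
            simp only [e2] at this
            linarith
      · rcases n with _ | n
        · exact Or.inl ⟨m, le_rfl, by simp [lpp_zero_zero]⟩
        · rcases ih m n (by omega) with ⟨k, hk, hle⟩ | ⟨k, hk, hle⟩
          · refine Or.inl ⟨k, by omega, ?_⟩
            have := lpp_add_le_up (fun z => w (z + ((k : ℤ) + 1, 1))) (m - k) n
            have e2 : ((((m - k : ℕ) : ℤ), (n : ℤ) + 1) + ((k : ℤ) + 1, 1) : ℤ × ℤ)
              = ((m : ℤ) + 1, ((n + 1 : ℕ) : ℤ) + 1) := by ext <;> simp; omega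
            simp only [e2] at this
            linarith
          · refine Or.inr ⟨k, by omega, ?_⟩
            have := lpp_add_le_up (fun z => w (z + (1, (k : ℤ) + 1))) m (n - k)
            have e : n + 1 - k = n - k + 1 := by omega
            rw [e]
            have e2 : (((m : ℤ), ((n - k : ℕ) : ℤ) + 1) + (1, (k : ℤ) + 1) : ℤ × ℤ)
              = ((m : ℤ) + 1, ((n + 1 : ℕ) : ℤ) + 1) := by ext <;> simp; omega
            simp only [e2] at this
            linarith
  exact key _ m n rfl

theorem lpp_row (w : ℤ × ℤ → ℝ) (m : ℕ) :
    lpp w m 0 = ∑ i ∈ Finset.range (m + 1), w (i, 0) := by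
  induction m with
  | zero => simp [lpp_zero_zero]
  | succ m ih => rw [lpp_succ_zero, ih, Finset.sum_range_succ _ (m + 1)]; simp

theorem lpp_column (w : ℤ × ℤ → ℝ) (n : ℕ) :
    lpp w 0 n = ∑ j ∈ Finset.range (n + 1), w (0, j) := by
  rw [← lpp_swap, lpp_row]; rfl

/-! ### Paths and the recursion -/

/-- The endpoint is quantified existentially, so that the induction also shows that the path stays
in the quadrant. Paths are functions on `ℕ` to avoid dependent indices. -/
theorem path_sum_le_lpp (w : ℤ × ℤ → ℝ) (q : ℕ → ℤ × ℤ) (n : ℕ) (h0 : q 0 = 0)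
    (hs : ∀ k < n, q (k + 1) = q k + (1, 0) ∨ q (k + 1) = q k + (0, 1)) :
    ∀ k ≤ n, ∃ i j : ℕ, q k = ((i : ℤ), (j : ℤ)) ∧
      ∑ l ∈ Finset.range (k + 1), w (q l) ≤ lpp w i j := by
  intro k
  induction k with
  | zero => intro _; exact ⟨0, 0, h0, by simp [h0, lpp_zero_zero]; rfl⟩
  | succ k ih =>
    intro hk
    obtain ⟨i, j, hq, hle⟩ := ih (by omega)
    rcases hs k (by omega) with h | h
    · refine ⟨i + 1, j, by rw [h, hq]; simp, ?_⟩
      rw [Finset.sum_range_succ, h, hq]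
      refine le_trans ?_ (lpp_add_le_right w i j)
      simpa using hle
    · refine ⟨i, j + 1, by rw [h, hq]; simp, ?_⟩
      rw [Finset.sum_range_succ, h, hq]
      refine le_trans ?_ (lpp_add_le_up w i j)
      simpa using hle

theorem exists_path_sum_eq_lpp (w : ℤ × ℤ → ℝ) (i j : ℕ) :
    ∃ q : ℕ → ℤ × ℤ, q 0 = 0 ∧ q (i + j) = ((i : ℤ), (j : ℤ)) ∧
      (∀ k < i + j, q (k + 1) = q k + (1, 0) ∨ q (k + 1) = q k + (0, 1)) ∧
      ∑ l ∈ Finset.range (i + j + 1), w (q l) = lpp w i j := by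
  have ext_path : ∀ (n : ℕ) (q : ℕ → ℤ × ℤ) (z z' : ℤ × ℤ) (s : ℝ), q 0 = 0 → q n = z →
      (∀ k < n, q (k + 1) = q k + (1, 0) ∨ q (k + 1) = q k + (0, 1)) →
      (z' = z + (1, 0) ∨ z' = z + (0, 1)) → ∑ l ∈ Finset.range (n + 1), w (q l) = s →
      ∃ q : ℕ → ℤ × ℤ, q 0 = 0 ∧ q (n + 1) = z' ∧
        (∀ k < n + 1, q (k + 1) = q k + (1, 0) ∨ q (k + 1) = q k + (0, 1)) ∧
        ∑ l ∈ Finset.range (n + 1 + 1), w (q l) = s + w z' := by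
    intro n q z z' s h0 hn hs hz hsum
    refine ⟨Function.update q (n + 1) z', ?_, by simp, ?_, ?_⟩
    · rw [Function.update_of_ne (by omega), h0]
    · intro k hk
      rw [Function.update_of_ne (a := k) (by omega)]
      rcases eq_or_ne k n with rfl | hkn
      · simpa [hn] using hz
      · rw [Function.update_of_ne (by omega)]
        exact hs k (by omega)
    · rw [Finset.sum_range_succ, ← hsum, Function.update_self]
      congr 1
      refine Finset.sum_congr rfl fun l hl => ?_
      rw [Function.update_of_ne]
      have := Finset.mem_range.1 hl
      omega
  induction i, j using grid_induction with
  | h00 => exact ⟨fun _ => 0, rfl, rfl, by simp, by simp [lpp_zero_zero]; rfl⟩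
  | h10 i ih =>
    obtain ⟨q, h0, h1, h2, h3⟩ := ih
    have := ext_path (i + 0) q _ ((i : ℤ) + 1, 0) _ h0 h1 h2 (Or.inl (by simp)) h3
    rw [lpp_succ_zero]
    simpa [add_right_comm] using this
  | h01 j ih =>
    obtain ⟨q, h0, h1, h2, h3⟩ := ih
    have := ext_path (0 + j) q _ (0, (j : ℤ) + 1) _ h0 h1 h2 (Or.inr (by simp)) h3
    rw [lpp_zero_succ]
    simpa using this
  | h11 i j ih1 ih2 =>
    rw [lpp_succ_succ]
    rcases max_cases (lpp w i (j + 1)) (lpp w (i + 1) j) with ⟨h, -⟩ | ⟨h, -⟩ <;> rw [h]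
    · obtain ⟨q, h0, h1, h2, h3⟩ := ih1
      have := ext_path (i + (j + 1)) q _ ((i : ℤ) + 1, (j : ℤ) + 1) _ h0 h1 h2
        (Or.inl (by simp)) h3
      rw [show i + 1 + (j + 1) = i + (j + 1) + 1 by omega]
      push_cast
      exact this
    · obtain ⟨q, h0, h1, h2, h3⟩ := ih2
      have := ext_path (i + 1 + j) q _ ((i : ℤ) + 1, (j : ℤ) + 1) _ h0 h1 h2
        (Or.inr (by simp)) h3
      push_cast
      exact this

theorem fin_path_sum_le_lpp (w : ℤ × ℤ → ℝ) {i j : ℕ} (n : ℕ) (p : Fin (n + 1) → ℤ × ℤ)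
    (h0 : p 0 = 0) (h1 : p (Fin.last n) = ((i : ℤ), (j : ℤ)))
    (h2 : ∀ k : Fin n, p k.succ = p k.castSucc + (1, 0) ∨ p k.succ = p k.castSucc + (0, 1)) :
    ∑ k, w (p k) ≤ lpp w i j := by
  obtain ⟨a, b, hab, hle⟩ := path_sum_le_lpp w
    (fun k => if h : k < n + 1 then p ⟨k, h⟩ else 0) n (by simpa using h0) (by
      intro k hk
      have := h2 ⟨k, hk⟩
      simp only [show k + 1 < n + 1 by omega, show k < n + 1 by omega, dite_true]
      exact this) n le_rfl
  have hp : ((i : ℤ), (j : ℤ)) = ((a : ℤ), (b : ℤ)) := by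
    rw [← hab, ← h1]
    simp [Fin.last]
  obtain ⟨rfl, rfl⟩ : i = a ∧ j = b := by
    simpa using hp
  refine le_trans (le_of_eq ?_) hle
  rw [← Fin.sum_univ_eq_sum_range
    (fun l => w (if h : l < n + 1 then p ⟨l, h⟩ else 0)) (n + 1)]
  exact Finset.sum_congr rfl fun k _ => by rw [dif_pos k.2]

theorem lastPassage_eq_lpp (w : ℤ × ℤ → ℝ) (i j : ℕ) :
    lastPassage w 0 ((i : ℤ), (j : ℤ)) = lpp w i j := by
  have hl : l1 (((i : ℤ), (j : ℤ)) - 0) = i + j := by simp [l1]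
  have hgr := isGreatest_lastPassage w (x := 0) (y := ((i : ℤ), (j : ℤ)))
    ⟨by simp, by simp⟩
  apply le_antisymm
  · obtain ⟨p, ⟨h0, h1, h2⟩, hs⟩ := hgr.1
    rw [hs]
    exact fin_path_sum_le_lpp w _ p h0 h1 h2
  · obtain ⟨q, h0, h1, h2, h3⟩ := exists_path_sum_eq_lpp w i j
    apply hgr.2
    refine ⟨fun k => q k, ⟨h0, ?_, fun k => h2 k (by have := k.2; omega)⟩, ?_⟩
    · simp only [Fin.val_last, hl, h1]
    · rw [Fin.sum_univ_eq_sum_range (fun l => w (q l)), hl, h3]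

theorem measurable_lpp {Ω : Type*} [MeasurableSpace Ω] {W : ℤ × ℤ → Ω → ℝ}
    (h : ∀ z, Measurable (W z)) (i j : ℕ) : Measurable fun ω => lpp (fun z => W z ω) i j := by
  induction i, j using grid_induction with
  | h00 => simpa [lpp_zero_zero] using h _
  | h10 i ih => simp only [lpp_succ_zero]; exact ih.add (h _)
  | h01 j ih => simp only [lpp_zero_succ]; exact ih.add (h _)
  | h11 i j ih1 ih2 => simp only [lpp_succ_succ]; exact (ih1.max ih2).add (h _)

/-! ### Burke's property for exponential variables -/

theorem lintegral_expMeasure (a : ℝ) {f : ℝ → ENNReal} (hf : Measurable f) :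
    ∫⁻ x, f x ∂expMeasure a = ∫⁻ x, exponentialPDF a x * f x := by
  have hm : Measurable (exponentialPDF a) := (measurable_exponentialPDFReal a).ennreal_ofReal
  have : expMeasure a = volume.withDensity (exponentialPDF a) := rfl
  rw [this, lintegral_withDensity_eq_lintegral_mul _ hm hf]
  rfl

/-- The density of the difference of independent exponential variables with rates `a`, `b`. -/
noncomputable def laplacePDF (a b u : ℝ) : ENNReal :=
  ENNReal.ofReal (a * b / (a + b) * if 0 ≤ u then Real.exp (-(a * u)) else Real.exp (b * u))

@[fun_prop]
theorem measurable_laplacePDF (a b : ℝ) : Measurable (laplacePDF a b) := by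
  unfold laplacePDF
  refine ENNReal.measurable_ofReal.comp (Measurable.const_mul ?_ _)
  exact Measurable.ite measurableSet_Ici (by fun_prop) (by fun_prop)

/-- With `m` the minimum and `u` the difference of the two variables, the joint density factors.
This is memorylessness at the level of densities. -/
theorem exponentialPDF_mul_of_nonneg {a b : ℝ} (ha : 0 < a) (hb : 0 < b) {u : ℝ} (hu : 0 ≤ u)
    (m : ℝ) : exponentialPDF a (m + u) * exponentialPDF b m =
      laplacePDF a b u * exponentialPDF (a + b) m := by
  rcases lt_or_ge m 0 with hm | hm
  · simp [exponentialPDF_of_neg hm]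
  · rw [exponentialPDF_of_nonneg hm, exponentialPDF_of_nonneg hm,
      exponentialPDF_of_nonneg (by positivity), laplacePDF, if_pos hu,
      ← ENNReal.ofReal_mul (by positivity), ← ENNReal.ofReal_mul (by positivity)]
    congr 1
    rw [show -((a + b) * m) = -(a * m) + -(b * m) by ring, mul_add, neg_add, Real.exp_add,
      Real.exp_add]
    field_simp

theorem exponentialPDF_mul_of_neg {a b : ℝ} (ha : 0 < a) (hb : 0 < b) {u : ℝ} (hu : u < 0)
    (m : ℝ) : exponentialPDF a m * exponentialPDF b (m - u) =
      laplacePDF a b u * exponentialPDF (a + b) m := by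
  rcases lt_or_ge m 0 with hm | hm
  · simp [exponentialPDF_of_neg hm]
  · rw [exponentialPDF_of_nonneg hm, exponentialPDF_of_nonneg hm,
      exponentialPDF_of_nonneg (by linarith), laplacePDF, if_neg (by linarith),
      ← ENNReal.ofReal_mul (by positivity), ← ENNReal.ofReal_mul (by positivity)]
    congr 1
    rw [show -((a + b) * m) = -(a * m) + -(b * m) by ring,
      show -(b * (m - u)) = -(b * m) + b * u by ring, Real.exp_add, Real.exp_add]
    field_simp

/-- The minimum and the difference of two independent exponential variables are independent, and
the minimum is exponential. -/
theorem lintegral_min_sub {a b : ℝ} (ha : 0 < a) (hb : 0 < b) {Φ : ℝ × ℝ → ENNReal}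
    (hΦ : Measurable Φ) :
    ∫⁻ p, Φ (min p.1 p.2, p.1 - p.2) ∂((expMeasure a).prod (expMeasure b)) =
      ∫⁻ u, ∫⁻ m, Φ (m, u) ∂expMeasure (a + b) ∂(volume.withDensity (laplacePDF a b)) := by
  have := isProbabilityMeasure_expMeasure ha
  have := isProbabilityMeasure_expMeasure hb
  have := isProbabilityMeasure_expMeasure (add_pos ha hb)
  have hm : ∀ c, Measurable (exponentialPDF c) :=
    fun c => (measurable_exponentialPDFReal c).ennreal_ofReal
  have hma := hm a
  have hmb := hm b
  have hmab := hm (a + b)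
  rw [lintegral_prod_symm' _ (by fun_prop), lintegral_expMeasure b (by fun_prop),
    lintegral_withDensity_eq_lintegral_mul _ (measurable_laplacePDF a b)
      (Measurable.lintegral_prod_left' (f := fun p : ℝ × ℝ => Φ (p.1, p.2)) (by fun_prop))]
  have h1 : ∀ y, exponentialPDF b y * ∫⁻ x, Φ (min x y, x - y) ∂expMeasure a =
      ∫⁻ u, exponentialPDF b y * (exponentialPDF a (u + y) * Φ (min (u + y) y, u)) := by
    intro y
    rw [lintegral_expMeasure a (by fun_prop), ← lintegral_const_mul _ (by fun_prop),
      ← lintegral_add_right_eq_self _ y]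
    simp
  simp only [h1]
  rw [lintegral_lintegral_swap (by fun_prop)]
  refine lintegral_congr fun u => ?_
  simp only [Pi.mul_apply]
  rw [lintegral_expMeasure _ (by fun_prop), ← lintegral_const_mul _ (by fun_prop)]
  -- The integration variable is the second coordinate, which is the minimum only if `0 ≤ u`. For `u
  -- < 0` a translation by `-u` makes it the minimum.
  rcases le_or_gt 0 u with hu | hu
  · refine lintegral_congr fun m => ?_
    rw [min_eq_right (by linarith), ← mul_assoc, ← mul_assoc,
      ← exponentialPDF_mul_of_nonneg ha hb hu, add_comm u m, mul_comm (exponentialPDF b m)]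
  · rw [← lintegral_add_right_eq_self _ (-u)]
    refine lintegral_congr fun m => ?_
    rw [min_eq_left (by linarith), ← mul_assoc, ← mul_assoc,
      ← exponentialPDF_mul_of_neg ha hb hu, mul_comm (exponentialPDF b _)]
    simp [sub_eq_add_neg]

/-- The update of the increments and the weight at a corner. -/
noncomputable def burkeMap (t : (ℝ × ℝ) × ℝ) : (ℝ × ℝ) × ℝ :=
  ((t.2 + max 0 (t.1.1 - t.1.2), t.2 + max 0 (t.1.2 - t.1.1)), min t.1.1 t.1.2)

@[fun_prop]
theorem measurable_burkeMap : Measurable burkeMap := by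
  unfold burkeMap; fun_prop

/-- In the coordinates minimum `m`, difference `u`, weight `w`, the map fixes `u` and exchanges `m`
and `w`. Since `a + b = 1`, both are Exp(1), and the three coordinates are independent, so the
exchange preserves the law. -/
theorem measurePreserving_burkeMap {a b : ℝ} (ha : 0 < a) (hb : 0 < b) (hab : a + b = 1) :
    MeasurePreserving burkeMap (((expMeasure a).prod (expMeasure b)).prod (expMeasure 1))
      (((expMeasure a).prod (expMeasure b)).prod (expMeasure 1)) := by
  have := isProbabilityMeasure_expMeasure ha
  have := isProbabilityMeasure_expMeasure hb
  have := isProbabilityMeasure_expMeasure one_pos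
  refine ⟨measurable_burkeMap, Measure.ext_of_lintegral _ fun f hf => ?_⟩
  set D := volume.withDensity (laplacePDF a b) with hD
  rw [lintegral_map hf measurable_burkeMap, lintegral_prod_symm' _ (by fun_prop),
    lintegral_prod_symm' _ hf]
  let Ψ : ℝ → ℝ → ℝ → ENNReal := fun w u m => f ((w + max 0 u, w + max 0 (-u)), m)
  have h1 : ∀ w, ∫⁻ p, f (burkeMap (p, w)) ∂((expMeasure a).prod (expMeasure b)) =
      ∫⁻ u, ∫⁻ m, Ψ w u m ∂expMeasure 1 ∂D := by
    intro w
    rw [← hab, ← lintegral_min_sub ha hb (Φ := fun q => Ψ w q.2 q.1) (by fun_prop)]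
    simp only [Ψ, burkeMap, neg_sub]
  have h2 : ∀ w, ∫⁻ p, f (p, w) ∂((expMeasure a).prod (expMeasure b)) =
      ∫⁻ u, ∫⁻ m, Ψ m u w ∂expMeasure 1 ∂D := by
    intro w
    rw [← hab, ← lintegral_min_sub ha hb (Φ := fun q => Ψ q.1 q.2 w) (by fun_prop)]
    refine lintegral_congr fun p => ?_
    simp only [Ψ]
    have e1 : min p.1 p.2 + max 0 (p.1 - p.2) = p.1 := by
      rcases le_total p.1 p.2 with h | h
      · rw [min_eq_left h, max_eq_left (by linarith)]; ring
      · rw [min_eq_right h, max_eq_right (by linarith)]; ring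
    have e2 : min p.1 p.2 + max 0 (-(p.1 - p.2)) = p.2 := by
      rcases le_total p.1 p.2 with h | h
      · rw [min_eq_left h, max_eq_right (by linarith)]; ring
      · rw [min_eq_right h, max_eq_left (by linarith)]; ring
    rw [e1, e2]
  simp only [h1, h2]
  have m1 : Measurable fun q : ℝ × ℝ => ∫⁻ m, Ψ q.1 q.2 m ∂expMeasure 1 :=
    Measurable.lintegral_prod_right' (f := fun q : (ℝ × ℝ) × ℝ => Ψ q.1.1 q.1.2 q.2) (by fun_prop)
  have m2 : Measurable fun q : ℝ × ℝ => ∫⁻ m, Ψ m q.2 q.1 ∂expMeasure 1 :=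
    Measurable.lintegral_prod_right' (f := fun q : (ℝ × ℝ) × ℝ => Ψ q.2 q.1.2 q.1.1) (by fun_prop)
  rw [lintegral_lintegral_swap m1.aemeasurable,
    lintegral_lintegral_swap (f := fun w u => ∫⁻ m, Ψ m u w ∂expMeasure 1) m2.aemeasurable]
  refine lintegral_congr fun u => ?_
  rw [lintegral_lintegral_swap (f := fun w m => Ψ w u m)]
  have : Measurable fun q : ℝ × ℝ => Ψ q.1 u q.2 := by fun_prop
  exact this.aemeasurable

theorem map_expMeasure_div {r : ℝ} (hr : 0 < r) :
    (expMeasure 1).map (fun x => x / r) = expMeasure r := by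
  have := isProbabilityMeasure_expMeasure hr
  have := isProbabilityMeasure_expMeasure one_pos
  have : IsProbabilityMeasure ((expMeasure 1).map (fun x => x / r)) :=
    Measure.isProbabilityMeasure_map (by fun_prop)
  refine Measure.eq_of_cdf _ _ ?_
  ext x
  rw [cdf_expMeasure_eq hr, cdf_eq_real, map_measureReal_apply (by fun_prop) measurableSet_Iic]
  have : (fun x => x / r) ⁻¹' Set.Iic x = Set.Iic (r * x) := by
    ext y; simp [div_le_iff₀ hr, mul_comm]
  rw [this, ← cdf_eq_real, cdf_expMeasure_eq one_pos]
  simp [mul_nonneg_iff_of_pos_left hr]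

/-! ### Families of independent exponential variables -/

/-- Independent exponential variables with the given rates. -/
structure IsExpFamily {Ω ι : Type*} [MeasurableSpace Ω] (P : Measure Ω) (rate : ι → ℝ)
    (X : ι → Ω → ℝ) : Prop where
  measurable : ∀ i, Measurable (X i)
  hasLaw : ∀ i, HasLaw (X i) (expMeasure (rate i)) P
  indep : iIndepFun X P

section
variable {Ω ι : Type*} [MeasurableSpace Ω] {P : Measure Ω} {rate : ι → ℝ} {X : ι → Ω → ℝ}

theorem IsExpFamily.precomp {κ : Type*} (h : IsExpFamily P rate X) {g : κ → ι}
    (hg : g.Injective) : IsExpFamily P (fun k => rate (g k)) (fun k => X (g k)) :=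
  ⟨fun _ => h.measurable _, fun _ => h.hasLaw _, h.indep.precomp hg⟩

theorem IsExpFamily.div (h : IsExpFamily P (fun _ => 1) X) (hr : ∀ i, 0 < rate i) :
    IsExpFamily P rate (fun i ω => X i ω / rate i) := by
  refine ⟨fun i => (h.measurable i).div_const _, fun i => ?_,
    h.indep.comp (fun i x => x / rate i) fun i => by fun_prop⟩
  have : HasLaw (fun x : ℝ => x / rate i) (expMeasure (rate i)) (expMeasure 1) :=
    ⟨by fun_prop, map_expMeasure_div (hr i)⟩
  exact this.fun_comp (h.hasLaw i)

/-- Burke's property: flipping a corner keeps the law of the family. -/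
theorem IsExpFamily.burke [IsProbabilityMeasure P] (h : IsExpFamily P rate X) {p q r : ι}
    (hpq : p ≠ q) (hpr : p ≠ r) (hqr : q ≠ r) (hp : 0 < rate p) (hq : 0 < rate q)
    (hpq1 : rate p + rate q = 1) (hr : rate r = 1) {Y : ι → Ω → ℝ}
    (hY : ∀ i, i ≠ p → i ≠ q → i ≠ r → Y i = X i)
    (hT : ∀ ω, ((Y p ω, Y q ω), Y r ω) = burkeMap ((X p ω, X q ω), X r ω)) :
    IsExpFamily P rate Y := by
  classical
  have i1 := isProbabilityMeasure_expMeasure hp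
  have i2 := isProbabilityMeasure_expMeasure hq
  have i3 := isProbabilityMeasure_expMeasure one_pos
  set T : Ω → (ℝ × ℝ) × ℝ := fun ω => ((X p ω, X q ω), X r ω) with hTdef
  set T' : Ω → (ℝ × ℝ) × ℝ := fun ω => ((Y p ω, Y q ω), Y r ω) with hT'def
  have hTm : Measurable T :=
    ((h.measurable p).prodMk (h.measurable q)).prodMk (h.measurable r)
  have hT' : T' = burkeMap ∘ T := funext hT
  have hTm' : Measurable T' := hT' ▸ measurable_burkeMap.comp hTm
  have hlawT : P.map T =
      ((expMeasure (rate p)).prod (expMeasure (rate q))).prod (expMeasure 1) := by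
    rw [hTdef, (h.indep.indepFun_prodMk h.measurable p q r hpr hqr).map_prod_eq_prod_map_map
      ((h.measurable p).prodMk (h.measurable q)).aemeasurable (h.measurable r).aemeasurable,
      (h.indep.indepFun hpq).map_prod_eq_prod_map_map
      (h.measurable p).aemeasurable (h.measurable q).aemeasurable, (h.hasLaw p).map_eq,
      (h.hasLaw q).map_eq, (h.hasLaw r).map_eq, hr]
  have hlawT' : P.map T' =
      ((expMeasure (rate p)).prod (expMeasure (rate q))).prod (expMeasure 1) := by
    rw [hT', ← Measure.map_map measurable_burkeMap hTm, hlawT]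
    exact (measurePreserving_burkeMap hp hq hpq1).map_eq
  have hYm : ∀ i, Measurable (Y i) := by
    intro i
    by_cases hip : i = p
    · subst hip; exact hTm'.fst.fst
    by_cases hiq : i = q
    · subst hiq; exact hTm'.fst.snd
    by_cases hir : i = r
    · subst hir; exact hTm'.snd
    rw [hY i hip hiq hir]; exact h.measurable i
  have lawp : P.map (Y p) = expMeasure (rate p) := by
    have : Y p = (fun t : (ℝ × ℝ) × ℝ => t.1.1) ∘ T' := rfl
    rw [this, ← Measure.map_map (by fun_prop) hTm', hlawT',
      show (fun t : (ℝ × ℝ) × ℝ => t.1.1) = Prod.fst ∘ Prod.fst from rfl,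
      ← Measure.map_map measurable_fst measurable_fst]
    simp [Measure.map_fst_prod]
  have lawq : P.map (Y q) = expMeasure (rate q) := by
    have : Y q = (fun t : (ℝ × ℝ) × ℝ => t.1.2) ∘ T' := rfl
    rw [this, ← Measure.map_map (by fun_prop) hTm', hlawT',
      show (fun t : (ℝ × ℝ) × ℝ => t.1.2) = Prod.snd ∘ Prod.fst from rfl,
      ← Measure.map_map measurable_snd measurable_fst]
    simp [Measure.map_fst_prod, Measure.map_snd_prod]
  have lawr : P.map (Y r) = expMeasure 1 := by
    have : Y r = (fun t : (ℝ × ℝ) × ℝ => t.2) ∘ T' := rfl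
    rw [this, ← Measure.map_map (by fun_prop) hTm', hlawT']
    simp [Measure.map_snd_prod]
  refine ⟨hYm, fun i => ⟨(hYm i).aemeasurable, ?_⟩, ?_⟩
  · by_cases hip : i = p
    · subst hip; exact lawp
    by_cases hiq : i = q
    · subst hiq; exact lawq
    by_cases hir : i = r
    · subst hir; rw [lawr, hr]
    rw [hY i hip hiq hir]; exact (h.hasLaw i).map_eq
  · rw [iIndepFun_iff_measure_inter_preimage_eq_mul]
    intro S sets hsets
    -- Padding by `Set.univ` outside `S` lets the triple `p, q, r` be treated as a block, whichever
    -- of its members belong to `S`.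
    set A : ι → Set ℝ := fun i => if i ∈ S then sets i else Set.univ with hA
    have hAm : ∀ i, MeasurableSet (A i) := by
      intro i
      by_cases hi : i ∈ S
      · simpa [hA, hi] using hsets i hi
      · simp [hA, hi]
    set R : Finset ι := S \ {p, q, r} with hR
    have hsplit : (⋂ i ∈ S, Y i ⁻¹' sets i) =
        T' ⁻¹' ((A p ×ˢ A q) ×ˢ A r) ∩ ⋂ i ∈ R, X i ⁻¹' A i := by
      ext ω
      simp only [Set.mem_iInter, Set.mem_preimage, Set.mem_inter_iff, Set.mem_prod, hT'def, hR,
        Finset.mem_sdiff, Finset.mem_insert, Finset.mem_singleton, not_or]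
      constructor
      · intro H
        have H' : ∀ i, Y i ω ∈ A i := by
          intro i
          by_cases hi : i ∈ S
          · simpa [hA, hi] using H i hi
          · simp [hA, hi]
        refine ⟨⟨⟨H' p, H' q⟩, H' r⟩, fun i hi => ?_⟩
        rw [← hY i hi.2.1 hi.2.2.1 hi.2.2.2]
        exact H' i
      · rintro ⟨⟨⟨hp', hq'⟩, hr'⟩, H⟩ i hi
        have hAi : A i = sets i := by simp [hA, hi]
        rw [← hAi]
        by_cases hip : i = p
        · subst hip; exact hp'
        by_cases hiq : i = q
        · subst hiq; exact hq'
        by_cases hir : i = r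
        · subst hir; exact hr'
        rw [hY i hip hiq hir]
        exact H i ⟨hi, hip, hiq, hir⟩
    have hdisj : Disjoint ({p, q, r} : Finset ι) R := Finset.disjoint_sdiff
    have hind : IndepFun T' (fun a (i : R) => X i a) P := by
      have := h.indep.indepFun_finset {p, q, r} R hdisj h.measurable
      have := this.comp (φ := fun x : (({p, q, r} : Finset ι) → ℝ) =>
        burkeMap ((x ⟨p, by simp⟩, x ⟨q, by simp⟩), x ⟨r, by simp⟩)) (ψ := id)
        (by fun_prop) measurable_id
      rw [hT']
      exact this
    have hpre : (⋂ i ∈ R, X i ⁻¹' A i) =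
        (fun a (i : R) => X i a) ⁻¹' (Set.univ.pi fun i : R => A i) := by
      ext ω; simp
    rw [hsplit, hpre, hind.measure_inter_preimage_eq_mul _ _
      (((hAm p).prod (hAm q)).prod (hAm r)) (MeasurableSet.univ_pi fun i => hAm i), ← hpre,
      h.indep.measure_inter_preimage_eq_mul R (fun i _ => hAm i),
      ← Measure.map_apply hTm' (((hAm p).prod (hAm q)).prod (hAm r)), hlawT',
      Measure.prod_prod, Measure.prod_prod]
    have hprod : ∏ i ∈ S, P (Y i ⁻¹' sets i) =
        ∏ i ∈ insert p (insert q (insert r R)), P (Y i ⁻¹' A i) := by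
      rw [← Finset.prod_subset (s₁ := S) (s₂ := insert p (insert q (insert r R)))]
      · refine Finset.prod_congr rfl fun i hi => ?_
        simp [hA, hi]
      · intro i hi
        simp only [hR, Finset.mem_insert, Finset.mem_sdiff, Finset.mem_singleton]
        tauto
      · intro i _ hi
        simp [hA, hi]
    rw [hprod, Finset.prod_insert (by simp [hpq, hpr, hR]), Finset.prod_insert (by simp [hqr, hR]),
      Finset.prod_insert (by simp [hR]), ← Measure.map_apply (hYm p) (hAm p), lawp,
      ← Measure.map_apply (hYm q) (hAm q), lawq, ← Measure.map_apply (hYm r) (hAm r), lawr,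
      mul_assoc, mul_assoc]
    congr 3
    refine Finset.prod_congr rfl fun i hi => ?_
    simp only [hR, Finset.mem_insert, Finset.mem_sdiff, Finset.mem_singleton, not_or] at hi
    rw [hY i hi.2.1 hi.2.2.1 hi.2.2.2]

end

/-! ### The stationary model -/

/-- The rates of the stationary model: `1 - ρ` on the horizontal axis, `ρ` on the vertical axis,
and `1` elsewhere. -/
noncomputable def statRate (ρ : ℝ) (z : ℤ × ℤ) : ℝ :=
  if z.2 = 0 then 1 - ρ else if z.1 = 0 then ρ else 1

theorem statRate_pos {ρ : ℝ} (h0 : 0 < ρ) (h1 : ρ < 1) (z : ℤ × ℤ) : 0 < statRate ρ z := by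
  unfold statRate; split_ifs <;> linarith

theorem statRate_le_one {ρ : ℝ} (h0 : 0 < ρ) (h1 : ρ < 1) (z : ℤ × ℤ) : statRate ρ z ≤ 1 := by
  unfold statRate; split_ifs <;> linarith

section
variable {Ω : Type*} [MeasurableSpace Ω] {P : Measure Ω} [IsProbabilityMeasure P]
  {X : ℤ × ℤ → Ω → ℝ} {ρ : ℝ}

/-- Column `i` is moved to column `i + 1` by flipping one corner at a time, from the bottom up. The
family `Y` records the state on the index set itself: the slot `(0, j' + 1)` holds the vertical
increment at height `j'`, already in column `i + 1` if `j' < j`; the slot `(i + 1, 0)` holds the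
horizontal increment at height `j`; unused weights stay in place. The minimum produced by a flip
goes into the slot of the weight just consumed, which keeps the family complete. -/
theorem exists_expFamily_increments_aux (h0 : 0 < ρ) (h1 : ρ < 1)
    (n i j : ℕ) (hj : j ≤ n)
    (h' : ∃ Y, IsExpFamily P (statRate ρ) Y ∧
      (∀ j' < n, ∀ ω, Y (0, (j' : ℤ) + 1) ω =
        lpp (fun z => X z ω) i (j' + 1) - lpp (fun z => X z ω) i j') ∧
      (∀ i' ≥ i, Y ((i' : ℤ) + 1, 0) = X ((i' : ℤ) + 1, 0)) ∧
      (∀ i' ≥ i, ∀ j' : ℕ, Y ((i' : ℤ) + 1, (j' : ℤ) + 1) = X ((i' : ℤ) + 1, (j' : ℤ) + 1))) :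
    ∃ Y, IsExpFamily P (statRate ρ) Y ∧
      (∀ j' < j, ∀ ω, Y (0, (j' : ℤ) + 1) ω =
        lpp (fun z => X z ω) (i + 1) (j' + 1) - lpp (fun z => X z ω) (i + 1) j') ∧
      (∀ j' ≥ j, j' < n → ∀ ω, Y (0, (j' : ℤ) + 1) ω =
        lpp (fun z => X z ω) i (j' + 1) - lpp (fun z => X z ω) i j') ∧
      (∀ ω, Y ((i : ℤ) + 1, 0) ω = lpp (fun z => X z ω) (i + 1) j - lpp (fun z => X z ω) i j) ∧
      (∀ i' > i, Y ((i' : ℤ) + 1, 0) = X ((i' : ℤ) + 1, 0)) ∧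
      (∀ j' ≥ j, Y ((i : ℤ) + 1, (j' : ℤ) + 1) = X ((i : ℤ) + 1, (j' : ℤ) + 1)) ∧
      (∀ i' > i, ∀ j' : ℕ, Y ((i' : ℤ) + 1, (j' : ℤ) + 1) = X ((i' : ℤ) + 1, (j' : ℤ) + 1)) := by
  induction j with
  | zero =>
    obtain ⟨Y, hY, hv, hh, hw⟩ := h'
    refine ⟨Y, hY, by simp, fun j' _ hj' => hv j' hj', fun ω => ?_,
      fun i' hi' => hh i' hi'.le, fun j' _ => hw i le_rfl j', fun i' hi' => hw i' hi'.le⟩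
    rw [hh i le_rfl, lpp_succ_zero]; ring
  | succ j ih =>
    obtain ⟨Y, hY, hv, hv', hI, hh, hw, hw'⟩ := ih (by omega)
    set p : ℤ × ℤ := ((i : ℤ) + 1, 0) with hp
    set q : ℤ × ℤ := (0, (j : ℤ) + 1) with hq
    set r : ℤ × ℤ := ((i : ℤ) + 1, (j : ℤ) + 1) with hr
    have hpq : p ≠ q := by simp [hp, hq]; omega
    have hpr : p ≠ r := by simp [hp, hr]; omega
    have hqr : q ≠ r := by simp [hq, hr]; omega
    let Y' : ℤ × ℤ → Ω → ℝ := fun z ω =>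
      if z = p then (burkeMap ((Y p ω, Y q ω), Y r ω)).1.1
      else if z = q then (burkeMap ((Y p ω, Y q ω), Y r ω)).1.2
      else if z = r then (burkeMap ((Y p ω, Y q ω), Y r ω)).2 else Y z ω
    have hY' : ∀ z, z ≠ p → z ≠ q → z ≠ r → Y' z = Y z := fun z h1 h2 h3 => by
      ext ω; simp [Y', h1, h2, h3]
    have hYp : ∀ ω, Y' p ω = Y r ω + max 0 (Y p ω - Y q ω) := fun ω => by
      simp [Y', burkeMap]
    have hYq : ∀ ω, Y' q ω = Y r ω + max 0 (Y q ω - Y p ω) := fun ω => by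
      simp [Y', burkeMap, hpq.symm]
    have hrec : ∀ ω, lpp (fun z => X z ω) (i + 1) (j + 1) =
        max (lpp (fun z => X z ω) i (j + 1)) (lpp (fun z => X z ω) (i + 1) j) + Y r ω := fun ω => by
      rw [lpp_succ_succ, hw j le_rfl]
    refine ⟨Y', hY.burke hpq hpr hqr (statRate_pos h0 h1 _) (statRate_pos h0 h1 _) ?_ ?_ hY'
      fun ω => ?_, ?_, ?_, fun ω => ?_, ?_, ?_, ?_⟩
    · have : (j : ℤ) + 1 ≠ 0 := by omega
      simp [statRate, hp, hq, this]
    · have h1 : (j : ℤ) + 1 ≠ 0 := by omega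
      have h2 : (i : ℤ) + 1 ≠ 0 := by omega
      simp [statRate, hr, h1, h2]
    · simp [Y', hpq.symm, hpr.symm, hqr.symm]
    · intro j' hj' ω
      rcases eq_or_ne j' j with rfl | hne
      · rw [hYq, hrec, hI, hv' j' le_rfl (by omega)]
        rcases le_total (lpp (fun z => X z ω) i (j' + 1)) (lpp (fun z => X z ω) (i + 1) j')
          with hle | hle
        · rw [max_eq_right hle, max_eq_left (by linarith)]; ring
        · rw [max_eq_left hle, max_eq_right (by linarith)]; ring
      · rw [hY' _ (by simp [hp]; omega) (by simp [hq]; omega) (by simp [hr]; omega)]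
        exact hv j' (by omega) ω
    · intro j' hj' hj'n ω
      rw [hY' _ (by simp [hp]; omega) (by simp [hq]; omega) (by simp [hr]; omega)]
      exact hv' j' (by omega) hj'n ω
    · rw [hYp, hrec, hI, hv' j le_rfl (by omega)]
      rcases le_total (lpp (fun z => X z ω) i (j + 1)) (lpp (fun z => X z ω) (i + 1) j)
        with hle | hle
      · rw [max_eq_right hle, max_eq_right (by linarith)]; ring
      · rw [max_eq_left hle, max_eq_left (by linarith)]; ring
    · intro i' hi'
      rw [hY' _ (by simp [hp]; omega) (by simp [hq]; omega) (by simp [hr]; omega)]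
      exact hh i' hi'
    · intro j' hj'
      rw [hY' _ (by simp [hp]; omega) (by simp [hq]; omega) (by simp [hr]; omega)]
      exact hw j' (by omega)
    · intro i' hi' j'
      rw [hY' _ (by simp [hp]; omega) (by simp [hq]; omega) (by simp [hr]; omega)]
      exact hw' i' hi' j'

/-- In the stationary model the vertical increments along a column are independent
exponential variables with rate `ρ`. -/
theorem exists_expFamily_increments (h0 : 0 < ρ) (h1 : ρ < 1)
    (h : IsExpFamily P (statRate ρ) X) (m n : ℕ) :
    ∃ Y, IsExpFamily P (statRate ρ) Y ∧ ∀ j < n, ∀ ω, Y (0, (j : ℤ) + 1) ω =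
      lpp (fun z => X z ω) m (j + 1) - lpp (fun z => X z ω) m j := by
  have key : ∃ Y, IsExpFamily P (statRate ρ) Y ∧
      (∀ j' < n, ∀ ω, Y (0, (j' : ℤ) + 1) ω =
        lpp (fun z => X z ω) m (j' + 1) - lpp (fun z => X z ω) m j') ∧
      (∀ i' ≥ m, Y ((i' : ℤ) + 1, 0) = X ((i' : ℤ) + 1, 0)) ∧
      (∀ i' ≥ m, ∀ j' : ℕ, Y ((i' : ℤ) + 1, (j' : ℤ) + 1) = X ((i' : ℤ) + 1, (j' : ℤ) + 1)) := by
    induction m with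
    | zero =>
      refine ⟨X, h, fun j _ ω => ?_, fun _ _ => rfl, fun _ _ _ => rfl⟩
      rw [lpp_zero_succ]; ring
    | succ m ih =>
      obtain ⟨Y, hY, hv, -, -, hh, -, hw⟩ :=
        exists_expFamily_increments_aux h0 h1 n m n le_rfl ih
      exact ⟨Y, hY, hv, fun i' hi' => hh i' hi', fun i' hi' => hw i' hi'⟩
  obtain ⟨Y, hY, hv, -⟩ := key
  exact ⟨Y, hY, hv⟩

/-- Go along the bottom row and then telescope up column `m`. Independence of the two sums from each
other is not needed, since a union bound controls their total. -/
theorem exists_lpp_eq_sum_add_sum (h0 : 0 < ρ) (h1 : ρ < 1)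
    (h : IsExpFamily P (statRate ρ) X) (m n : ℕ) :
    ∃ Y, IsExpFamily P (statRate ρ) Y ∧ ∀ ω, lpp (fun z => X z ω) m n =
      ∑ i ∈ Finset.range (m + 1), X (i, 0) ω + ∑ j ∈ Finset.range n, Y (0, (j : ℤ) + 1) ω := by
  obtain ⟨Y, hY, hv⟩ := exists_expFamily_increments h0 h1 h m n
  refine ⟨Y, hY, fun ω => ?_⟩
  rw [← lpp_row (fun z => X z ω), Finset.sum_congr rfl fun j hj => hv j (Finset.mem_range.1 hj) ω,
    Finset.sum_range_sub]
  ring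

end

/-! ### Chernoff bounds -/

theorem lintegral_exp_expMeasure {r t : ℝ} (hr : 0 < r) (ht : t < r) :
    ∫⁻ x, ENNReal.ofReal (Real.exp (t * x)) ∂expMeasure r = ENNReal.ofReal (r / (r - t)) := by
  have hrt : 0 < r - t := by linarith
  rw [lintegral_expMeasure r (by fun_prop)]
  have : ∀ x, exponentialPDF r x * ENNReal.ofReal (Real.exp (t * x)) =
      ENNReal.ofReal (r / (r - t)) * exponentialPDF (r - t) x := by
    intro x
    rcases lt_or_ge x 0 with hx | hx
    · simp [exponentialPDF_of_neg hx]
    · rw [exponentialPDF_of_nonneg hx, exponentialPDF_of_nonneg hx,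
        ← ENNReal.ofReal_mul (by positivity), ← ENNReal.ofReal_mul (by positivity)]
      congr 1
      rw [mul_assoc, ← Real.exp_add, ← mul_assoc, div_mul_cancel₀ _ hrt.ne']
      congr 2
      ring
  simp only [this]
  have hm : Measurable (exponentialPDF (r - t)) :=
    (measurable_exponentialPDFReal _).ennreal_ofReal
  rw [lintegral_const_mul _ hm, lintegral_exponentialPDF_eq_one hrt, mul_one]

theorem mgf_id_expMeasure {r t : ℝ} (hr : 0 < r) (ht : t < r) :
    mgf id (expMeasure r) t = r / (r - t) := by
  rw [mgf, integral_eq_lintegral_of_nonneg_ae (Eventually.of_forall fun x => (Real.exp_pos _).le)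
    (by fun_prop)]
  simp only [id]
  rw [lintegral_exp_expMeasure hr ht, ENNReal.toReal_ofReal]
  have : 0 < r - t := by linarith
  positivity

theorem integrable_exp_expMeasure {r t : ℝ} (hr : 0 < r) (ht : t < r) :
    Integrable (fun x => Real.exp (t * x)) (expMeasure r) := by
  refine ⟨by fun_prop, ?_⟩
  rw [hasFiniteIntegral_iff_ofReal (Eventually.of_forall fun x => (Real.exp_pos _).le),
    lintegral_exp_expMeasure hr ht]
  exact ENNReal.ofReal_lt_top

/-- Bounds the moment generating function of an exponential variable at relative tilt `u`. Negative
`u` is allowed, so that one inequality serves both tails. -/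
theorem one_div_one_sub_le_exp {u : ℝ} (h2 : u ≤ 1 / 2) :
    1 / (1 - u) ≤ Real.exp (u + u ^ 2) := by
  have h := Real.add_one_le_exp (u + u ^ 2)
  have h3 : 0 < 1 - u := by linarith
  rw [div_le_iff₀ h3]
  rcases le_total 0 u with hu | hu
  · have h4 := Real.quadratic_le_exp_of_nonneg (x := u + u ^ 2) (by positivity)
    have : 1 ≤ (1 + (u + u ^ 2) + (u + u ^ 2) ^ 2 / 2) * (1 - u) := by
      nlinarith [mul_nonneg hu hu, mul_nonneg (mul_nonneg hu hu) hu,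
        mul_nonneg (mul_nonneg hu hu) (mul_nonneg hu hu),
        mul_nonneg (mul_nonneg (mul_nonneg hu hu) hu) (sub_nonneg.2 h2),
        mul_nonneg (mul_nonneg hu hu) (sub_nonneg.2 h2)]
    exact this.trans (mul_le_mul_of_nonneg_right h4 h3.le)
  · have : 1 ≤ ((u + u ^ 2) + 1) * (1 - u) := by
      nlinarith [mul_nonneg (neg_nonneg.2 hu) (sq_nonneg u)]
    exact this.trans (mul_le_mul_of_nonneg_right h h3.le)

section
variable {Ω ι : Type*} [MeasurableSpace Ω] {P : Measure Ω} {rate : ι → ℝ} {X : ι → Ω → ℝ}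

theorem IsExpFamily.mgf_sum (h : IsExpFamily P rate X) {r t : ℝ} (hr : 0 < r) (ht : t < r)
    (s : Finset ι) (hs : ∀ i ∈ s, rate i = r) :
    mgf (∑ i ∈ s, X i) P t = (r / (r - t)) ^ s.card := by
  rw [h.indep.mgf_sum h.measurable, Finset.prod_eq_pow_card]
  intro i hi
  rw [← mgf_id_map (h.measurable i).aemeasurable, (h.hasLaw i).map_eq, hs i hi,
    mgf_id_expMeasure hr ht]

theorem IsExpFamily.integrable_exp_sum [IsProbabilityMeasure P] (h : IsExpFamily P rate X)
    {r t : ℝ} (hr : 0 < r) (ht : t < r) (s : Finset ι) (hs : ∀ i ∈ s, rate i = r) :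
    Integrable (fun ω => Real.exp (t * (∑ i ∈ s, X i) ω)) P := by
  refine h.indep.integrable_exp_mul_sum h.measurable fun i hi => ?_
  have := integrable_exp_expMeasure hr ht
  rw [← hs i hi, ← (h.hasLaw i).map_eq] at this
  exact this.comp_measurable (h.measurable i)

theorem pow_div_sub_le_exp {r u : ℝ} (hr : 0 < r) (h2 : u ≤ 1 / 2) (n : ℕ) :
    (r / (r - u * r)) ^ n ≤ Real.exp (n * (u + u ^ 2)) := by
  have : r / (r - u * r) = 1 / (1 - u) := by
    rw [show r - u * r = r * (1 - u) by ring]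
    field_simp
  rw [this, Real.exp_nat_mul]
  exact pow_le_pow_left₀ (by have : 0 < 1 - u := by linarith
                             positivity) (one_div_one_sub_le_exp h2) n

/-- `K` is only an upper bound for the number of terms, so that sums of different lengths share one
deviation scale. -/
theorem IsExpFamily.sum_upper_tail [IsProbabilityMeasure P] (h : IsExpFamily P rate X)
    {r ε K : ℝ} (hr : 0 < r) (hr1 : r ≤ 1) (hε : 0 < ε) (hε1 : ε ≤ 1)
    (s : Finset ι) (hs : ∀ i ∈ s, rate i = r) (hK : (s.card : ℝ) ≤ K) :
    P.real {ω | s.card / r + ε * K ≤ ∑ i ∈ s, X i ω} ≤ Real.exp (-(r ^ 2 * ε ^ 2 / 4 * K)) := by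
  -- With this tilt the gain `u * r * ε * K` equals `2 * u ^ 2 * K`, and the second-order term costs
  -- at most `u ^ 2 * K`.
  set u : ℝ := r * ε / 2 with hu
  have hu0 : 0 < u := by positivity
  have hu2 : u ≤ 1 / 2 := by rw [hu]; nlinarith
  have hur : u * r < r := by nlinarith
  have := measure_ge_le_exp_mul_mgf (X := ∑ i ∈ s, X i) (s.card / r + ε * K) (t := u * r)
    (by positivity) (h.integrable_exp_sum hr hur s hs)
  rw [h.mgf_sum hr hur s hs] at this
  simp only [Finset.sum_apply] at this
  refine this.trans ((mul_le_mul_of_nonneg_left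
    (pow_div_sub_le_exp hr hu2 _) (Real.exp_pos _).le).trans ?_)
  rw [← Real.exp_add, Real.exp_le_exp]
  have e : -(u * r) * (s.card / r + ε * K) + s.card * (u + u ^ 2) =
      -(r ^ 2 * ε ^ 2 / 4 * K) + (s.card - K) * u ^ 2 := by
    rw [hu]; field_simp; ring
  rw [e]
  nlinarith [sq_nonneg u]

theorem IsExpFamily.sum_lower_tail [IsProbabilityMeasure P] (h : IsExpFamily P rate X)
    {r ε K : ℝ} (hr : 0 < r) (hr1 : r ≤ 1) (hε : 0 < ε) (hε1 : ε ≤ 1)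
    (s : Finset ι) (hs : ∀ i ∈ s, rate i = r) (hK : (s.card : ℝ) ≤ K) :
    P.real {ω | ∑ i ∈ s, X i ω ≤ s.card / r - ε * K} ≤ Real.exp (-(r ^ 2 * ε ^ 2 / 4 * K)) := by
  set u : ℝ := r * ε / 2 with hu
  have hu0 : 0 < u := by positivity
  have hu2 : u ≤ 1 / 2 := by rw [hu]; nlinarith
  have hur : -u * r < r := by nlinarith
  have := measure_le_le_exp_mul_mgf (X := ∑ i ∈ s, X i) (s.card / r - ε * K) (t := -u * r)
    (by nlinarith) (h.integrable_exp_sum hr hur s hs)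
  rw [h.mgf_sum hr hur s hs] at this
  simp only [Finset.sum_apply] at this
  refine this.trans ((mul_le_mul_of_nonneg_left
    (pow_div_sub_le_exp hr (by linarith) _) (Real.exp_pos _).le).trans ?_)
  rw [← Real.exp_add, Real.exp_le_exp]
  have e : -(-u * r) * (s.card / r - ε * K) + s.card * (-u + (-u) ^ 2) =
      -(r ^ 2 * ε ^ 2 / 4 * K) + (s.card - K) * u ^ 2 := by
    rw [hu]; field_simp; ring
  rw [e]
  nlinarith [sq_nonneg u]

theorem IsExpFamily.ae_nonneg [Countable ι] (h : IsExpFamily P rate X) :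
    ∀ᵐ ω ∂P, ∀ i, 0 ≤ X i ω := by
  refine ae_all_iff.2 fun i => ?_
  rw [(h.hasLaw i).ae_iff (p := fun x => 0 ≤ x) (by fun_prop)]
  have hm : MeasurableSet {x : ℝ | 0 ≤ x} := measurableSet_Ici
  rw [ae_iff]
  change volume.withDensity (exponentialPDF (rate i)) _ = 0
  have hs : MeasurableSet {x : ℝ | ¬ 0 ≤ x} := hm.compl
  rw [withDensity_apply _ hs]
  refine (setLIntegral_congr_fun hs (g := fun _ => 0) fun x hx => ?_).trans (by simp)
  exact exponentialPDF_of_neg (not_le.1 hx)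

end

theorem measureReal_union_le_add {Ω : Type*} [MeasurableSpace Ω] {P : Measure Ω}
    {s t : Set Ω} {x y : ℝ} (hs : P.real s ≤ x) (ht : P.real t ≤ y) :
    P.real (s ∪ t) ≤ x + y :=
  (measureReal_union_le _ _).trans (add_le_add hs ht)

theorem exp_neg_le_exp_neg {r ρ ε K : ℝ} (hr : 0 ≤ r) (h : r ≤ ρ) (hK : 0 ≤ K) :
    Real.exp (-(ρ ^ 2 * ε ^ 2 / 4 * K)) ≤ Real.exp (-(r ^ 2 * ε ^ 2 / 4 * K)) := by
  rw [Real.exp_le_exp, neg_le_neg_iff]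
  gcongr

section
variable {Ω : Type*} [MeasurableSpace Ω] {P : Measure Ω} [IsProbabilityMeasure P]

theorem measureReal_le_of_ae_imp {s t : Set Ω} (h : ∀ᵐ ω ∂P, ω ∈ s → ω ∈ t) :
    P.real s ≤ P.real t :=
  ENNReal.toReal_mono (measure_ne_top _ _) (measure_mono_ae h)

theorem statRate_axis (ρ : ℝ) (i : ℤ) : statRate ρ (i, 0) = 1 - ρ := by simp [statRate]

theorem statRate_axis' (ρ : ℝ) (j : ℕ) : statRate ρ (0, (j : ℤ) + 1) = ρ := by
  have : (j : ℤ) + 1 ≠ 0 := by omega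
  simp [statRate, this]

/-- Tails of sums of variables on the horizontal axis. -/
theorem IsExpFamily.axis_sum_tails {X : ℤ × ℤ → Ω → ℝ} {ρ r ε K : ℝ}
    (h : IsExpFamily P (statRate ρ) X) (hr : 0 < r) (hρ : r ≤ ρ) (hρ' : r ≤ 1 - ρ)
    (hε : 0 < ε) (hε1 : ε ≤ 1) (k : ℕ) (hK : (k : ℝ) ≤ K) :
    P.real {ω | k / (1 - ρ) + ε * K ≤ ∑ i ∈ Finset.range k, X (i, 0) ω} ≤
        Real.exp (-(r ^ 2 * ε ^ 2 / 4 * K)) ∧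
      P.real {ω | ∑ i ∈ Finset.range k, X (i, 0) ω ≤ k / (1 - ρ) - ε * K} ≤
        Real.exp (-(r ^ 2 * ε ^ 2 / 4 * K)) ∧
      P.real {ω | k / ρ + ε * K ≤ ∑ j ∈ Finset.range k, X (0, (j : ℤ) + 1) ω} ≤
        Real.exp (-(r ^ 2 * ε ^ 2 / 4 * K)) ∧
      P.real {ω | ∑ j ∈ Finset.range k, X (0, (j : ℤ) + 1) ω ≤ k / ρ - ε * K} ≤
        Real.exp (-(r ^ 2 * ε ^ 2 / 4 * K)) := by
  have hK0 : 0 ≤ K := (Nat.cast_nonneg k).trans hK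
  have hx := h.precomp (g := fun i : ℕ => ((i : ℤ), (0 : ℤ))) (fun i j hij => by simpa using hij)
  have hy := h.precomp (g := fun j : ℕ => ((0 : ℤ), (j : ℤ) + 1))
    (fun i j hij => by simpa using hij)
  have e1 := exp_neg_le_exp_neg (ε := ε) hr.le hρ hK0
  have e2 := exp_neg_le_exp_neg (ε := ε) hr.le hρ' hK0
  have a1 := hx.sum_upper_tail (r := 1 - ρ) (K := K) (by linarith) (by linarith) hε hε1
    (Finset.range k) (fun i _ => statRate_axis ρ i) (by simpa using hK)
  have a2 := hx.sum_lower_tail (r := 1 - ρ) (K := K) (by linarith) (by linarith) hε hε1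
    (Finset.range k) (fun i _ => statRate_axis ρ i) (by simpa using hK)
  have a3 := hy.sum_upper_tail (r := ρ) (K := K) (by linarith) (by linarith) hε hε1
    (Finset.range k) (fun i _ => statRate_axis' ρ i) (by simpa using hK)
  have a4 := hy.sum_lower_tail (r := ρ) (K := K) (by linarith) (by linarith) hε hε1
    (Finset.range k) (fun i _ => statRate_axis' ρ i) (by simpa using hK)
  rw [Finset.card_range] at a1 a2 a3 a4
  exact ⟨a1.trans e2, a2.trans e2, a3.trans e1, a4.trans e1⟩

/-- Exponential concentration of the stationary last-passage value. -/
theorem IsExpFamily.lpp_stat_tails {X : ℤ × ℤ → Ω → ℝ} {ρ r ε K : ℝ}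
    (h : IsExpFamily P (statRate ρ) X) (hr : 0 < r) (hρ : r ≤ ρ) (hρ' : r ≤ 1 - ρ)
    (hε : 0 < ε) (hε1 : ε ≤ 1) (m n : ℕ) (hm : (m : ℝ) + 1 ≤ K) (hn : (n : ℝ) ≤ K) :
    P.real {ω | (m + 1) / (1 - ρ) + n / ρ + 2 * ε * K ≤ lpp (fun z => X z ω) m n} ≤
        2 * Real.exp (-(r ^ 2 * ε ^ 2 / 4 * K)) ∧
      P.real {ω | lpp (fun z => X z ω) m n ≤ (m + 1) / (1 - ρ) + n / ρ - 2 * ε * K} ≤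
        2 * Real.exp (-(r ^ 2 * ε ^ 2 / 4 * K)) := by
  obtain ⟨Y, hY, hsum⟩ := exists_lpp_eq_sum_add_sum (by linarith) (by linarith) h m n
  obtain ⟨a1, a2, -, -⟩ := h.axis_sum_tails hr hρ hρ' hε hε1 (m + 1) (by push_cast; exact hm)
  obtain ⟨-, -, a3, a4⟩ := hY.axis_sum_tails hr hρ hρ' hε hε1 n hn
  push_cast at a1 a2
  rw [two_mul (Real.exp _)]
  constructor
  · refine (measureReal_mono ?_).trans (measureReal_union_le_add a1 a3)
    intro ω hω
    simp only [Set.mem_ofPred_eq, Set.mem_union, hsum] at hω ⊢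
    by_contra! hcon
    linarith
  · refine (measureReal_mono ?_).trans (measureReal_union_le_add a2 a4)
    intro ω hω
    simp only [Set.mem_ofPred_eq, Set.mem_union, hsum] at hω ⊢
    by_contra! hcon
    linarith

/-! ### The shape function and the upper tail -/

theorem gpp_swap (x y : ℝ) : gpp (x, y) = gpp (y, x) := by simp [gpp, add_comm]

theorem gpp_eq {x y : ℝ} (hx : 0 ≤ x) (hy : 0 ≤ y) : gpp (x, y) = x + y + 2 * (√x * √y) := by
  simp only [gpp]
  nlinarith [Real.sq_sqrt hx, Real.sq_sqrt hy]

/-- The characteristic parameter attached to a slightly enlarged rectangle. -/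
theorem exists_density_upper {M N K s : ℝ} (hM : 0 < M) (hN : 0 < N) (hK : M + N ≤ K)
    (hs : 0 < s) (hs1 : s ≤ 1 / 8) :
    ∃ ρ, s / 4 ≤ ρ ∧ s / 4 ≤ 1 - ρ ∧
      M / (1 - ρ) + N / ρ ≤ gpp (M, N) + (4 * s ^ 2 + 4 * s) * K := by
  have hK0 : 0 < K := by linarith
  -- Enlarging both sides by `2 * s ^ 2 * K` puts `a` and `b` between `s * √K` and `2 * √K`, which
  -- keeps `ρ = b / (a + b)` away from 0 and 1. The price is only of order `s * K`, because `(a + b)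
  -- ^ 2` bounds the stationary mean.
  set a := √(M + 2 * s ^ 2 * K) with ha
  set b := √(N + 2 * s ^ 2 * K) with hb
  set k := √K with hk
  have hs2 : s ^ 2 ≤ 1 / 64 := by nlinarith
  have ha2 : a ^ 2 = M + 2 * s ^ 2 * K := Real.sq_sqrt (by positivity)
  have hb2 : b ^ 2 = N + 2 * s ^ 2 * K := Real.sq_sqrt (by positivity)
  have hk2 : k ^ 2 = K := Real.sq_sqrt hK0.le
  have ha0 : 0 < a := Real.sqrt_pos.2 (by positivity)
  have hb0 : 0 < b := Real.sqrt_pos.2 (by positivity)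
  have hk0 : 0 < k := Real.sqrt_pos.2 hK0
  have hs2K : 2 * s ^ 2 * K ≤ K / 32 := by nlinarith
  have hs2K' : 0 < s ^ 2 * K := by positivity
  have ha_up : a ≤ 2 * k := abs_le_of_sq_le_sq' (by nlinarith) (by positivity) |>.2
  have hb_up : b ≤ 2 * k := abs_le_of_sq_le_sq' (by nlinarith) (by positivity) |>.2
  have ha_lo : s * k ≤ a := abs_le_of_sq_le_sq' (by rw [mul_pow, hk2, ha2]; nlinarith) ha0.le |>.2
  have hb_lo : s * k ≤ b := abs_le_of_sq_le_sq' (by rw [mul_pow, hk2, hb2]; nlinarith) hb0.le |>.2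
  have h1ρ : 1 - b / (a + b) = a / (a + b) := by field_simp; ring
  refine ⟨b / (a + b), ?_, ?_, ?_⟩
  · rw [le_div_iff₀ (by positivity)]; nlinarith
  · rw [h1ρ, le_div_iff₀ (by positivity)]; nlinarith
  · rw [h1ρ]
    have e1 : M / (a / (a + b)) ≤ a * (a + b) := by
      rw [div_le_iff₀ (by positivity)]
      have : a * (a + b) * (a / (a + b)) = a ^ 2 := by field_simp
      rw [this, ha2]; linarith
    have e2 : N / (b / (a + b)) ≤ b * (a + b) := by
      rw [div_le_iff₀ (by positivity)]
      have : b * (a + b) * (b / (a + b)) = b ^ 2 := by field_simp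
      rw [this, hb2]; linarith
    have e3 : a * b ≤ √M * √N + 2 * s * K := by
      refine abs_le_of_sq_le_sq' ?_ (by positivity) |>.2
      have h1 : (√M * √N) ^ 2 = M * N := by rw [mul_pow, Real.sq_sqrt hM.le, Real.sq_sqrt hN.le]
      have h2 : 0 ≤ √M * √N * (2 * s * K) := by positivity
      have h3 : (a * b) ^ 2 ≤ M * N + (2 * s * K) ^ 2 := by
        rw [mul_pow, ha2, hb2]
        have h4 : s ^ 2 * K * (M + N) ≤ s ^ 2 * K * K := by gcongr
        have h5 : s ^ 2 * (s ^ 2 * K ^ 2) ≤ 1 / 64 * (s ^ 2 * K ^ 2) := by gcongr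
        have h6 : 0 ≤ s ^ 2 * K ^ 2 := by positivity
        nlinarith
      nlinarith
    rw [gpp_eq hM.le hN.le]
    nlinarith

/-- Upper tail of the last-passage value. -/
theorem IsExpFamily.lpp_upper_tail {W : ℤ × ℤ → Ω → ℝ} (h : IsExpFamily P (fun _ => 1) W)
    {ε K : ℝ} (hε : 0 < ε) (hε1 : ε ≤ 1) (m n : ℕ) (hK : (m : ℝ) + 1 + (n + 1) ≤ K) :
    P.real {ω | gpp ((m : ℝ) + 1, (n : ℝ) + 1) + ε * K ≤ lpp (fun z => W z ω) m n} ≤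
      2 * Real.exp (-((ε / 32) ^ 2 * (ε / 8) ^ 2 / 4 * K)) := by
  obtain ⟨ρ, h1, h2, h3⟩ := exists_density_upper (s := ε / 8) (by positivity) (by positivity) hK
    (by positivity) (by linarith)
  have hr : ε / 8 / 4 = ε / 32 := by ring
  rw [hr] at h1 h2
  have hρ0 : 0 < ρ := by linarith
  have hρ1 : ρ < 1 := by linarith
  have hm0 : (0 : ℝ) ≤ m := Nat.cast_nonneg m
  have hn0 : (0 : ℝ) ≤ n := Nat.cast_nonneg n
  have hX := h.div (fun z => statRate_pos hρ0 hρ1 z)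
  refine (measureReal_le_of_ae_imp ?_).trans (hX.lpp_stat_tails (by positivity) h1 h2
    (ε := ε / 8) (K := K) (by positivity) (by linarith) m n (by linarith) (by linarith)).1
  filter_upwards [h.ae_nonneg] with ω hω hle
  change _ ≤ _ at hle
  show _ ≤ _
  -- The coupling: dividing by rates at most 1 can only enlarge the weights.
  have hmono : lpp (fun z => W z ω) m n ≤ lpp (fun z => W z ω / statRate ρ z) m n :=
    lpp_le_lpp (fun i j => le_div_self (hω _) (statRate_pos hρ0 hρ1 _)
      (statRate_le_one hρ0 hρ1 _)) m n
  have hn : (n : ℝ) / ρ ≤ (n + 1) / ρ := by gcongr; linarith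
  have : (4 * (ε / 8) ^ 2 + 4 * (ε / 8)) * K + 2 * (ε / 8) * K ≤ ε * K := by
    have : 0 ≤ K := by linarith
    have h5 : ε ^ 2 * K ≤ ε * K := by gcongr; nlinarith
    nlinarith [mul_nonneg hε.le this]
  linarith

end

/-! ### The lower tail -/

/-- The loss incurred by leaving the axis at distance `k` in the characteristic direction. -/
theorem mul_add_gpp_le {M N k : ℝ} (hM : 0 < M) (hN : 0 < N) (hk : 0 ≤ k) (hkM : k ≤ M) :
    k * (√M + √N) / √M + gpp (M - k, N) ≤ gpp (M, N) - √N / √M * (k ^ 2 / (4 * M)) := by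
  set a := √M with ha
  set b := √N with hb
  set s := √(M - k) with hs
  have ha2 : a ^ 2 = M := Real.sq_sqrt hM.le
  have hb2 : b ^ 2 = N := Real.sq_sqrt hN.le
  have hs2 : s ^ 2 = M - k := Real.sq_sqrt (by linarith)
  have ha0 : 0 < a := Real.sqrt_pos.2 hM
  have hb0 : 0 < b := Real.sqrt_pos.2 hN
  have hs0 : 0 ≤ s := Real.sqrt_nonneg _
  have hsa : s ≤ a := Real.sqrt_le_sqrt (by linarith)
  have hkk : k = a ^ 2 - s ^ 2 := by linarith
  -- The slope `(a + b) / a` is `1 / (1 - ρ)` at the characteristic `ρ`. It cancels the first-order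
  -- term exactly and leaves a square.
  have e : k * (a + b) / a + gpp (M - k, N) = gpp (M, N) - b / a * (a - s) ^ 2 := by
    simp only [gpp, ← ha, ← hb, ← hs]
    rw [hkk]
    field_simp
    ring
  rw [e]
  have : k ^ 2 / (4 * M) ≤ (a - s) ^ 2 := by
    rw [div_le_iff₀ (by positivity), ← ha2, hkk]
    nlinarith [sq_nonneg (a - s), mul_nonneg (sq_nonneg (a - s)) (mul_nonneg (sub_nonneg.2 hsa)
      (by linarith : 0 ≤ 3 * a + s))]
  have : b / a * (k ^ 2 / (4 * M)) ≤ b / a * (a - s) ^ 2 := by gcongr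
  linarith

/-- A path leaving the axis at distance `k` with near-optimal total weight forces the weight
collected after the exit to be near-optimal. -/
theorem sub_le_of_exit {M N K k r ε θ δ L : ℝ} (hM : 0 < M) (hN : 0 < N) (hMN : M + N = K)
    (hk : 0 ≤ k) (hkM : k ≤ M) (hr : 0 < r) (hba : r ≤ √N / √M) (hab : r ≤ √M / (√M + √N))
    (hθ : 0 < θ) (hδ : δ = r * ε / 4) (hε : 0 < ε) (hθ1 : 40 * θ ≤ r * δ ^ 2)
    (hθ2 : 16 * θ ≤ ε) (hK1 : 8 ≤ r ^ 2 * δ ^ 2 * K) (hK2 : 4 ≤ r * ε * K)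
    (h1 : gpp (M, N) - 4 * θ * K - 1 / r ≤ k * (√M + √N) / √M + L)
    (h2 : L ≤ gpp (M - k, N) + θ * K) : gpp (M, N) - ε * K < L := by
  have hK0 : 0 < K := by linarith
  have hδ0 : 0 < δ := by rw [hδ]; positivity
  have hloss := mul_add_gpp_le hM hN hk hkM
  have hr1 : 1 / r ≤ r * δ ^ 2 / 8 * K := by
    rw [div_le_iff₀ hr]; nlinarith
  -- The quadratic loss cannot exceed the total slack `5 * θ * K + 1 / r`, which the choice of `θ`
  -- and the size of `K` keep below `r * δ ^ 2 / 4 * K`.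
  have hk2 : k ^ 2 ≤ (δ * K) ^ 2 := by
    have e1 : r * (k ^ 2 / (4 * K)) ≤ √N / √M * (k ^ 2 / (4 * M)) := by
      gcongr; linarith
    have e2 : r * (k ^ 2 / (4 * K)) ≤ 5 * θ * K + 1 / r := by linarith
    have e3 : r * (k ^ 2 / (4 * K)) ≤ r * δ ^ 2 / 4 * K := by
      have : 40 * θ * K ≤ r * δ ^ 2 * K := by gcongr
      linarith
    rw [show r * (k ^ 2 / (4 * K)) = r * k ^ 2 / (4 * K) by ring,
      div_le_iff₀ (by positivity)] at e3
    have e4 : r * k ^ 2 ≤ r * (δ * K) ^ 2 := by nlinarith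
    exact le_of_mul_le_mul_left e4 hr
  have hkδ : k ≤ δ * K := abs_le_of_sq_le_sq' hk2 (by positivity) |>.2
  have hs0 : 0 < √M := Real.sqrt_pos.2 hM
  have ht0 : 0 < √N := Real.sqrt_pos.2 hN
  have e5 : k * (√M + √N) / √M ≤ ε / 4 * K := by
    rw [div_le_iff₀ hs0]
    rw [le_div_iff₀ (by positivity)] at hab
    have : k * (√M + √N) ≤ (δ * K) * (√M + √N) := by gcongr
    have e6 : ε / 4 * K * (r * (√M + √N)) ≤ ε / 4 * K * √M := by gcongr
    rw [hδ] at this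
    linarith
  have e7 : 1 / r ≤ ε / 4 * K := by
    rw [div_le_iff₀ hr]; linarith
  have e8 : 4 * θ * K ≤ ε / 4 * K := by nlinarith
  have e9 : 0 < ε * K := by positivity
  linarith

theorem IsExpFamily.shift {Ω : Type*} [MeasurableSpace Ω] {P : Measure Ω}
    {W : ℤ × ℤ → Ω → ℝ} (h : IsExpFamily P (fun _ => 1) W) (v : ℤ × ℤ) :
    IsExpFamily P (fun _ => 1) (fun z => W (z + v)) :=
  h.precomp (g := fun z => z + v) (add_left_injective v)

/-- The stationary weights with interior weights `W` shifted to start at `(1, 1)`. -/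
noncomputable def statWeights {Ω : Type*} (ρ : ℝ) (W : ℤ × ℤ → Ω → ℝ) (z : ℤ × ℤ) (ω : Ω) : ℝ :=
  W (z + (-1, -1)) ω / statRate ρ z

theorem IsExpFamily.statWeights {Ω : Type*} [MeasurableSpace Ω] {P : Measure Ω}
    {W : ℤ × ℤ → Ω → ℝ} (h : IsExpFamily P (fun _ => 1) W) {ρ : ℝ}
    (h0 : 0 < ρ) (h1 : ρ < 1) : IsExpFamily P (statRate ρ) (statWeights ρ W) :=
  (h.shift (-1, -1)).div (fun z => statRate_pos h0 h1 z)

/-- Strictly inside the quadrant the rate is 1, so a path that has left the axes sees only the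
original weights. -/
theorem statWeights_shift {Ω : Type*} (ρ : ℝ) (W : ℤ × ℤ → Ω → ℝ) (ω : Ω) (k l i j : ℕ) :
    lpp (fun z => statWeights ρ W (z + ((k : ℤ) + 1, (l : ℤ) + 1)) ω) i j =
      lpp (fun z => W (z + ((k : ℤ), (l : ℤ))) ω) i j := by
  refine lpp_congr (fun i j => ?_) i j
  have h1 : ((i : ℤ) + ((k : ℤ) + 1)) ≠ 0 := by omega
  have h2 : ((j : ℤ) + ((l : ℤ) + 1)) ≠ 0 := by omega
  have h3 : (i : ℤ) + ((k : ℤ) + 1) + -1 = i + k := by ring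
  have h4 : (j : ℤ) + ((l : ℤ) + 1) + -1 = j + l := by ring
  simp only [statWeights, statRate, Prod.mk_add_mk, h1, h2, h3, h4, if_false, div_one]

section
variable {Ω : Type*} [MeasurableSpace Ω] {P : Measure Ω} [IsProbabilityMeasure P]

/-- Near an axis the lower tail is controlled by a single row or column. -/
theorem IsExpFamily.lpp_lower_tail_axis {W : ℤ × ℤ → Ω → ℝ} (h : IsExpFamily P (fun _ => 1) W)
    {ε K : ℝ} (hε : 0 < ε) (hε1 : ε ≤ 1) (m n : ℕ) (hK : (m : ℝ) + 1 + (n + 1) = K)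
    (hax : (m : ℝ) + 1 ≤ (ε / 8) ^ 2 * K ∨ (n : ℝ) + 1 ≤ (ε / 8) ^ 2 * K) :
    P.real {ω | lpp (fun z => W z ω) m n ≤ gpp ((m : ℝ) + 1, (n : ℝ) + 1) - ε * K} ≤
      Real.exp (-(1 ^ 2 * (ε / 8) ^ 2 / 4 * K)) := by
  have hm0 : (0 : ℝ) ≤ m := Nat.cast_nonneg m
  have hn0 : (0 : ℝ) ≤ n := Nat.cast_nonneg n
  have hK0 : 0 < K := by linarith
  -- Both `y` and `√x * √y` are at most `ε / 8 * K`, so `gpp (x, y)` exceeds `x`, the mean of the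
  -- single long row or column, by at most `3 * ε / 8 * K`.
  have key : ∀ x y : ℝ, 0 ≤ x → 0 ≤ y → x + y = K → y ≤ (ε / 8) ^ 2 * K →
      gpp (x, y) - ε * K ≤ x - ε / 8 * K := by
    intro x y hx hy hxy hyK
    have h1 : √x * √y ≤ ε / 8 * K := by
      refine abs_le_of_sq_le_sq' ?_ (by positivity) |>.2
      rw [mul_pow, Real.sq_sqrt hx, Real.sq_sqrt hy]
      have : x * y ≤ K * ((ε / 8) ^ 2 * K) := by
        gcongr; linarith
      nlinarith
    rw [gpp_eq hx hy]
    have : (ε / 8) ^ 2 * K ≤ ε / 8 * K := by gcongr; nlinarith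
    have : 0 ≤ ε * K := by positivity
    linarith
  rcases hax with hax | hax
  · have hy := h.precomp (g := fun j : ℕ => ((0 : ℤ), (j : ℤ))) (fun i j hij => by simpa using hij)
    have := hy.sum_lower_tail (r := 1) (ε := ε / 8) (K := K) one_pos le_rfl (by positivity)
      (by linarith) (Finset.range (n + 1)) (fun i _ => rfl) (by simp; linarith)
    refine (measureReal_le_of_ae_imp ?_).trans this
    filter_upwards [h.ae_nonneg] with ω hω hle
    change _ ≤ _ at hle
    rw [← lpp_column (fun z => W z ω), Finset.card_range]
    refine (lpp_mono (fun z => hω z) (Nat.zero_le m) le_rfl).trans (hle.trans ?_)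
    rw [gpp_swap]
    simpa using key _ _ (by positivity) (by positivity) (by linarith) hax
  · have hx := h.precomp (g := fun i : ℕ => ((i : ℤ), (0 : ℤ))) (fun i j hij => by simpa using hij)
    have := hx.sum_lower_tail (r := 1) (ε := ε / 8) (K := K) one_pos le_rfl (by positivity)
      (by linarith) (Finset.range (m + 1)) (fun i _ => rfl) (by simp; linarith)
    refine (measureReal_le_of_ae_imp ?_).trans this
    filter_upwards [h.ae_nonneg] with ω hω hle
    change _ ≤ _ at hle
    rw [← lpp_row (fun z => W z ω), Finset.card_range]
    refine (lpp_mono (fun z => hω z) le_rfl (Nat.zero_le n)).trans (hle.trans ?_)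
    simpa using key _ _ (by positivity) (by positivity) hK hax

/-- Lower tail of the last-passage value away from the axes. -/
theorem IsExpFamily.lpp_lower_tail_interior {W : ℤ × ℤ → Ω → ℝ}
    (h : IsExpFamily P (fun _ => 1) W)
    {ε K r θ δ c : ℝ} (hε : 0 < ε) (m n : ℕ) (hK : (m : ℝ) + 1 + (n + 1) = K)
    (hr : 0 < r) (hMr : (2 * r) ^ 2 * K ≤ m + 1) (hNr : (2 * r) ^ 2 * K ≤ n + 1)
    (hθ : 0 < θ) (hθ3 : θ ≤ 1) (hδ : δ = r * ε / 4) (hθ1 : 40 * θ ≤ r * δ ^ 2)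
    (hθ2 : 16 * θ ≤ ε) (hK1 : 8 ≤ r ^ 2 * δ ^ 2 * K) (hK2 : 4 ≤ r * ε * K)
    (hc1 : c ≤ r ^ 2 * θ ^ 2 / 4) (hc2 : c ≤ (θ / 32) ^ 2 * (θ / 8) ^ 2 / 4) :
    P.real {ω | lpp (fun z => W z ω) m n ≤ gpp ((m : ℝ) + 1, (n : ℝ) + 1) - ε * K} ≤
      6 * K * Real.exp (-(c * K)) := by
  have hm0 : (0 : ℝ) ≤ m := Nat.cast_nonneg m
  have hn0 : (0 : ℝ) ≤ n := Nat.cast_nonneg n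
  have hM : (0 : ℝ) < m + 1 := by positivity
  have hN : (0 : ℝ) < n + 1 := by positivity
  have hK0 : 0 < K := by linarith
  set a := √((m : ℝ) + 1) with ha
  set b := √((n : ℝ) + 1) with hb
  have ha2 : a ^ 2 = m + 1 := Real.sq_sqrt hM.le
  have hb2 : b ^ 2 = n + 1 := Real.sq_sqrt hN.le
  have hk2 : √K ^ 2 = K := Real.sq_sqrt hK0.le
  have ha0 : 0 < a := Real.sqrt_pos.2 hM
  have hb0 : 0 < b := Real.sqrt_pos.2 hN
  have haK : a ≤ √K := Real.sqrt_le_sqrt (by linarith)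
  have hbK : b ≤ √K := Real.sqrt_le_sqrt (by linarith)
  have haK' : 2 * r * √K ≤ a :=
    abs_le_of_sq_le_sq' (by rw [mul_pow, hk2, ha2]; exact hMr) ha0.le |>.2
  have hbK' : 2 * r * √K ≤ b :=
    abs_le_of_sq_le_sq' (by rw [mul_pow, hk2, hb2]; exact hNr) hb0.le |>.2
  have hra : r ≤ a / (a + b) := by rw [le_div_iff₀ (by positivity)]; nlinarith
  have hrb : r ≤ b / (a + b) := by rw [le_div_iff₀ (by positivity)]; nlinarith
  have hba : r ≤ b / a := hrb.trans (by gcongr; linarith)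
  have hab : r ≤ a / b := hra.trans (by gcongr; linarith)
  set ρ := b / (a + b) with hρ
  have h1ρ : 1 - ρ = a / (a + b) := by rw [hρ]; field_simp; ring
  have hρ1 : r ≤ 1 - ρ := h1ρ ▸ hra
  have hX := h.statWeights (ρ := ρ) (by linarith) (by linarith)
  set X := CornerGrowth.statWeights ρ W with hXdef
  set e := Real.exp (-(c * K)) with he
  have he0 : 0 < e := Real.exp_pos _
  have he1 : Real.exp (-(r ^ 2 * θ ^ 2 / 4 * K)) ≤ e := by
    rw [he, Real.exp_le_exp, neg_le_neg_iff]; gcongr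
  have he2 : Real.exp (-((θ / 32) ^ 2 * (θ / 8) ^ 2 / 4 * K)) ≤ e := by
    rw [he, Real.exp_le_exp, neg_le_neg_iff]; gcongr
  have pstat := ((hX.lpp_stat_tails hr hrb hρ1 hθ hθ3 (K := K) (m + 1) (n + 1)
    (by push_cast; linarith) (by push_cast; linarith)).2).trans
    (mul_le_mul_of_nonneg_left he1 two_pos.le)
  -- A path up the vertical axis starts at the origin, whose rate is `1 - ρ` rather than `ρ`; that
  -- one weight is estimated separately.
  have pcorner := ((hX.axis_sum_tails hr hrb hρ1 hθ hθ3 (K := K) 1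
    (by push_cast; linarith)).1).trans he1
  have prow : ∀ k ∈ Finset.range (m + 1), _ := fun k hk =>
    ((hX.axis_sum_tails hr hrb hρ1 hθ hθ3 (K := K) (k + 2) (by
      have : (k : ℝ) ≤ m := Nat.cast_le.2 (Nat.lt_succ_iff.1 (Finset.mem_range.1 hk))
      push_cast; linarith)).1).trans he1
  have pcol : ∀ k ∈ Finset.range (n + 1), _ := fun k hk =>
    ((hX.axis_sum_tails hr hrb hρ1 hθ hθ3 (K := K) (k + 1) (by
      have : (k : ℝ) ≤ n := Nat.cast_le.2 (Nat.lt_succ_iff.1 (Finset.mem_range.1 hk))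
      push_cast; linarith)).2.2.1).trans he1
  have pright : ∀ k ∈ Finset.range (m + 1), _ := fun k hk =>
    ((h.shift ((k : ℤ), ((0 : ℕ) : ℤ))).lpp_upper_tail hθ hθ3 (K := K) (m - k) n (by
      have : k ≤ m := Nat.lt_succ_iff.1 (Finset.mem_range.1 hk)
      push_cast [this]
      have : (0 : ℝ) ≤ k := Nat.cast_nonneg k
      linarith)).trans (mul_le_mul_of_nonneg_left he2 two_pos.le)
  have pup : ∀ k ∈ Finset.range (n + 1), _ := fun k hk =>
    ((h.shift (((0 : ℕ) : ℤ), (k : ℤ))).lpp_upper_tail hθ hθ3 (K := K) m (n - k) (by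
      have : k ≤ n := Nat.lt_succ_iff.1 (Finset.mem_range.1 hk)
      push_cast [this]
      have : (0 : ℝ) ≤ k := Nat.cast_nonneg k
      linarith)).trans (mul_le_mul_of_nonneg_left he2 two_pos.le)
  have pH : P.real (⋃ k ∈ Finset.range (m + 1), _) ≤ (m + 1) * (3 * e) :=
    (measureReal_biUnion_finset_le _ _).trans ((Finset.sum_le_sum fun k hk =>
      (measureReal_union_le_add (prow k hk) (pright k hk)).trans
        (by linarith : e + 2 * e ≤ 3 * e)).trans (by simp))
  have pV : P.real (⋃ k ∈ Finset.range (n + 1), _) ≤ (n + 1) * (3 * e) :=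
    (measureReal_biUnion_finset_le _ _).trans ((Finset.sum_le_sum fun k hk =>
      (measureReal_union_le_add (pcol k hk) (pup k hk)).trans
        (by linarith : e + 2 * e ≤ 3 * e)).trans (by simp))
  refine (measureReal_le_of_ae_imp ?_).trans ((measureReal_union_le_add
    (measureReal_union_le_add (measureReal_union_le_add pstat pcorner) pH) pV).trans ?_)
  swap
  · have : e ≤ K * e := le_mul_of_one_le_left he0.le (by linarith)
    calc _ = 3 * e + 3 * (K * e) := by rw [← hK]; ring
      _ ≤ _ := by linarith
  filter_upwards [h.ae_nonneg] with ω hω hle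
  by_contra hcon
  simp only [Set.mem_union, Set.mem_iUnion, Set.mem_ofPred_eq, not_or, not_exists, not_le,
    Finset.mem_range] at hcon
  obtain ⟨⟨⟨hstat, hcorner⟩, hH⟩, hV⟩ := hcon
  change lpp (fun z => W z ω) m n ≤ gpp ((m : ℝ) + 1, (n : ℝ) + 1) - ε * K at hle
  have hA : gpp ((m : ℝ) + 1, (n : ℝ) + 1) =
      ((m : ℝ) + 1) * (1 / (1 - ρ)) + ((n : ℝ) + 1) * (1 / ρ) := by
    rw [h1ρ, hρ, ← ha2, ← hb2]
    simp only [gpp, Real.sqrt_sq ha0.le, Real.sqrt_sq hb0.le]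
    field_simp
  have hi1 : 1 / (1 - ρ) = (a + b) / a := by rw [h1ρ, one_div_div]
  have hi2 : 1 / ρ = (b + a) / b := by rw [hρ, one_div_div, add_comm]
  have hi1r : 1 / (1 - ρ) ≤ 1 / r := by gcongr
  have hi2r : 1 / ρ ≤ 1 / r := by gcongr
  push_cast at hstat hH hV hcorner
  rw [div_eq_mul_one_div _ (1 - ρ), div_eq_mul_one_div _ ρ] at hstat
  rw [Finset.sum_range_one] at hcorner
  -- Outside the exceptional events the exit decomposition is nearly optimal. The slack `4 * θ * K`
  -- collects `2 * θ * K` from the stationary value and `θ * K` each from the axis sum and the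
  -- corner (the horizontal case does not need the latter); `1 / r` absorbs the extra axis weight.
  rcases exists_exit_point (fun z => X z ω) m n with ⟨k, hk, hx⟩ | ⟨k, hk, hx⟩
  · obtain ⟨hrow, hright⟩ := hH k (by omega)
    have hkm : (k : ℝ) ≤ m := Nat.cast_le.2 hk
    have hsh := statWeights_shift ρ W ω k 0 (m - k) n
    simp only [Nat.cast_zero, zero_add, ← hXdef] at hsh
    have hle2 := lpp_shift_right_le' (w := fun z => W z ω) (fun z => hω z) k (m - k) n
    rw [Nat.sub_add_cancel hk] at hle2
    rw [hsh, lpp_row] at hx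
    rw [div_eq_mul_one_div] at hrow
    rw [Nat.cast_sub hk] at hright
    refine absurd (sub_le_of_exit (k := k) hM hN hK (Nat.cast_nonneg k)
      (by linarith) hr hba hra hθ hδ hε
      hθ1 hθ2 hK1 hK2 (L := lpp (fun z => W (z + ((k : ℤ), 0)) ω) (m - k) n) ?_ ?_) ?_
    · rw [mul_div_assoc, ← ha, ← hb, ← hi1]
      have : 0 < θ * K := by positivity
      linarith
    · rw [show (m : ℝ) + 1 - k = m - k + 1 by ring]
      exact hright.le
    · rw [not_lt]
      exact hle2.trans hle
  · obtain ⟨hcol, hup⟩ := hV k (by omega)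
    have hkn : (k : ℝ) ≤ n := Nat.cast_le.2 hk
    have hsh := statWeights_shift ρ W ω 0 k m (n - k)
    simp only [Nat.cast_zero, zero_add, ← hXdef] at hsh
    have hle2 := lpp_shift_up_le (w := fun z => W z ω) (fun z => hω z) k m (n - k)
    rw [Nat.sub_add_cancel hk] at hle2
    rw [hsh, lpp_column, Finset.sum_range_succ'] at hx
    rw [div_eq_mul_one_div] at hcol
    rw [Nat.cast_sub hk] at hup
    push_cast at hx hcorner
    refine absurd (sub_le_of_exit (k := k) hN hM ((add_comm _ _).trans hK) (Nat.cast_nonneg k)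
      (by linarith) hr hab (by rw [add_comm √_]; exact hrb) hθ hδ hε
      hθ1 hθ2 hK1 hK2 (L := lpp (fun z => W (z + (0, (k : ℤ))) ω) m (n - k)) ?_ ?_) ?_
    · rw [mul_div_assoc, ← ha, ← hb, ← hi2, gpp_swap]
      have : 0 < 1 / (1 - ρ) := by rw [hi1]; positivity
      linarith
    · rw [show (n : ℝ) + 1 - k = n - k + 1 by ring, gpp_swap]
      exact hup.le
    · rw [not_lt, gpp_swap]
      exact hle2.trans hle

end

/-- Absorbs the factor `K` left by the union bound over exit points, at the price of half the rate.
-/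
theorem mul_exp_neg_le {c K : ℝ} (hc : 0 < c) :
    K * Real.exp (-(c * K)) ≤ 2 / c * Real.exp (-(c / 2 * K)) := by
  have h := Real.add_one_le_exp (c / 2 * K)
  have h2 : K ≤ 2 / c * Real.exp (c / 2 * K) := by
    rw [div_mul_eq_mul_div, le_div_iff₀ hc]; linarith
  calc K * Real.exp (-(c * K)) ≤ 2 / c * Real.exp (c / 2 * K) * Real.exp (-(c * K)) := by gcongr
    _ = _ := by rw [mul_assoc, ← Real.exp_add]; congr 2; ring

section
variable {Ω : Type*} [MeasurableSpace Ω] {P : Measure Ω} [IsProbabilityMeasure P]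

/-- Lower tail of the last-passage value. -/
theorem IsExpFamily.lpp_lower_tail {W : ℤ × ℤ → Ω → ℝ} (h : IsExpFamily P (fun _ => 1) W)
    {ε : ℝ} (hε : 0 < ε) (hε1 : ε ≤ 1) :
    ∃ C c : ℝ, 0 < c ∧ ∀ (m n : ℕ) (K : ℝ), (m : ℝ) + 1 + (n + 1) = K →
      P.real {ω | lpp (fun z => W z ω) m n ≤ gpp ((m : ℝ) + 1, (n : ℝ) + 1) - ε * K} ≤
        C * Real.exp (-(c * K)) := by
  set r := ε / 16 with hr
  set δ := r * ε / 4 with hδ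
  set θ := r * δ ^ 2 / 40 with hθ
  have hr0 : 0 < r := by positivity
  have hr1 : r ≤ 1 := by rw [hr]; linarith
  have hδ0 : 0 < δ := by positivity
  have hδ1 : δ ≤ 1 := by rw [hδ]; nlinarith
  have hδ2 : δ ^ 2 ≤ 1 := by nlinarith
  have hθ0 : 0 < θ := by positivity
  have hθ1 : 16 * θ ≤ ε := by rw [hθ, hr]; nlinarith
  set c := min (min (r ^ 2 * θ ^ 2 / 4) ((θ / 32) ^ 2 * (θ / 8) ^ 2 / 4))
    (1 ^ 2 * (ε / 8) ^ 2 / 4) with hc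
  have hc0 : 0 < c := by rw [hc]; positivity
  set K₀ := max (8 / (r ^ 2 * δ ^ 2)) (4 / (r * ε)) with hK₀
  have hK₀0 : 0 < K₀ := lt_max_of_lt_left (by positivity)
  -- The three summands serve three cases: `K < K₀`, where probabilities are bounded by 1; the
  -- interior, with its factor `6 * K`; and the neighbourhood of the axes.
  refine ⟨Real.exp (c * K₀) + 12 / c + 1, c / 2, by positivity, fun m n K hK => ?_⟩
  have hm0 : (0 : ℝ) ≤ m := Nat.cast_nonneg m
  have hn0 : (0 : ℝ) ≤ n := Nat.cast_nonneg n
  have hK0 : 0 < K := by linarith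
  have hE : 0 < Real.exp (-(c / 2 * K)) := Real.exp_pos _
  have hEK : 0 < Real.exp (c * K₀) := Real.exp_pos _
  have h12 : 0 < 12 / c := by positivity
  rcases lt_or_ge K K₀ with hlt | hge
  · refine measureReal_le_one.trans ?_
    have : 1 ≤ Real.exp (c * K₀) * Real.exp (-(c / 2 * K)) := by
      rw [← Real.exp_add]
      refine Real.one_le_exp ?_
      nlinarith
    nlinarith
  · by_cases hax : (m : ℝ) + 1 ≤ (ε / 8) ^ 2 * K ∨ (n : ℝ) + 1 ≤ (ε / 8) ^ 2 * K
    · refine (h.lpp_lower_tail_axis hε hε1 m n hK hax).trans ?_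
      have : Real.exp (-(1 ^ 2 * (ε / 8) ^ 2 / 4 * K)) ≤ Real.exp (-(c / 2 * K)) := by
        rw [Real.exp_le_exp, neg_le_neg_iff]
        have : c ≤ 1 ^ 2 * (ε / 8) ^ 2 / 4 := min_le_right _ _
        nlinarith
      nlinarith
    · push Not at hax
      have h2r : 2 * r = ε / 8 := by rw [hr]; ring
      have hc1 : c ≤ r ^ 2 * θ ^ 2 / 4 := (min_le_left _ _).trans (min_le_left _ _)
      have hc2 : c ≤ (θ / 32) ^ 2 * (θ / 8) ^ 2 / 4 := (min_le_left _ _).trans (min_le_right _ _)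
      refine (h.lpp_lower_tail_interior hε m n hK hr0 (by rw [h2r]; exact hax.1.le)
        (by rw [h2r]; exact hax.2.le) hθ0 (by linarith) hδ (by rw [hθ]; linarith) hθ1 ?_ ?_ hc1
        hc2).trans ?_
      · have := (le_max_left _ _).trans hge
        rwa [div_le_iff₀ (by positivity), mul_comm] at this
      · have := (le_max_right _ _).trans hge
        rwa [div_le_iff₀ (by positivity), mul_comm] at this
      · have := mul_exp_neg_le (K := K) hc0
        have e : 12 / c = 6 * (2 / c) := by ring
        nlinarith [mul_pos hEK hE]

/-! ### Borel–Cantelli and the uniform law -/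

/-- A Borel–Cantelli lemma for events indexed by the quadrant. -/
theorem ae_exists_forall_notMem {E : ℕ × ℕ → Set Ω} {C c : ℝ} (hc : 0 < c)
    (h : ∀ m n : ℕ, P.real (E (m, n)) ≤ C * Real.exp (-(c * ((m : ℝ) + 1 + (n + 1))))) :
    ∀ᵐ ω ∂P, ∃ K : ℕ, ∀ m n : ℕ, K ≤ m + n → ω ∉ E (m, n) := by
  have hs : Summable fun n : ℕ => Real.exp (-(c * ((n : ℝ) + 1))) := by
    have : ∀ n : ℕ, Real.exp (-(c * ((n : ℝ) + 1))) = Real.exp (-c) * Real.exp (-c) ^ n := by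
      intro n
      rw [← Real.exp_nat_mul, ← Real.exp_add]; congr 1; ring
    simp only [this]
    exact (summable_geometric_of_lt_one (Real.exp_pos _).le
      (Real.exp_lt_one_iff.2 (by linarith))).mul_left _
  have hs2 : Summable fun q : ℕ × ℕ =>
      C * (Real.exp (-(c * ((q.1 : ℝ) + 1))) * Real.exp (-(c * ((q.2 : ℝ) + 1)))) :=
    (hs.mul_of_nonneg hs (fun _ => (Real.exp_pos _).le) fun _ => (Real.exp_pos _).le).mul_left C
  have hle : ∀ q : ℕ × ℕ, P (E q) ≤ ENNReal.ofReal
      (C * (Real.exp (-(c * ((q.1 : ℝ) + 1))) * Real.exp (-(c * ((q.2 : ℝ) + 1))))) := by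
    rintro ⟨m, n⟩
    rw [← ofReal_measureReal]
    refine ENNReal.ofReal_le_ofReal ((h m n).trans_eq ?_)
    rw [← Real.exp_add]
    congr 2
    ring
  have hfin : ∑' q, P (E q) ≠ ⊤ :=
    ne_top_of_le_ne_top hs2.tsum_ofReal_ne_top (ENNReal.tsum_le_tsum hle)
  filter_upwards [ae_finite_setOfPred_mem hfin] with ω hf
  obtain ⟨K, hK⟩ := (hf.image fun q => q.1 + q.2).bddAbove
  refine ⟨K + 1, fun m n hmn hmem => ?_⟩
  have := hK ⟨(m, n), hmem, rfl⟩
  simp at this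
  omega

theorem gpp_nonneg (ξ : ℝ × ℝ) : 0 ≤ gpp ξ := sq_nonneg _

theorem gpp_mono {x y x' y' : ℝ} (hx : x ≤ x') (hy : y ≤ y') : gpp (x, y) ≤ gpp (x', y') := by
  simp only [gpp]
  gcongr

theorem add_le_gpp {x y : ℝ} (hx : 0 ≤ x) (hy : 0 ≤ y) : x + y ≤ gpp (x, y) := by
  rw [gpp_eq hx hy]
  have := mul_nonneg (Real.sqrt_nonneg x) (Real.sqrt_nonneg y)
  linarith

theorem gpp_le_two_mul {x y : ℝ} (hx : 0 ≤ x) (hy : 0 ≤ y) : gpp (x, y) ≤ 2 * (x + y) := by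
  rw [gpp_eq hx hy]
  nlinarith [sq_nonneg (√x - √y), Real.sq_sqrt hx, Real.sq_sqrt hy]

/-- Near the axes `gpp` is not Lipschitz, so a unit shift is paid for by a small relative error plus
a constant: `√(z + 1) ≤ √z + 1`, then the arithmetic-geometric mean inequality on the cross term. -/
theorem gpp_add_one_le {x y e : ℝ} (hx : 0 ≤ x) (hy : 0 ≤ y) (he : 0 < e) :
    gpp (x + 1, y + 1) ≤ (1 + e) * gpp (x, y) + (4 + 4 / e) := by
  have h : ∀ z, 0 ≤ z → √(z + 1) ≤ √z + 1 := fun z hz => by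
    rw [Real.sqrt_le_left (by positivity)]
    nlinarith [Real.sq_sqrt hz, Real.sqrt_nonneg z]
  simp only [gpp]
  set g := √x + √y with hg
  have hg0 : 0 ≤ g := by positivity
  have h1 : √(x + 1) + √(y + 1) ≤ g + 2 := by linarith [h x hx, h y hy]
  have h2 : (√(x + 1) + √(y + 1)) ^ 2 ≤ (g + 2) ^ 2 := by gcongr
  have h3 : 4 * g ≤ e * g ^ 2 + 4 / e := by
    have : e * g ^ 2 + 4 / e - 4 * g = (e * g - 2) ^ 2 / e := by field_simp; ring
    have : 0 ≤ (e * g - 2) ^ 2 / e := by positivity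
    linarith
  nlinarith

/-- The uniform law of large numbers, along the recursion `lpp`. -/
theorem IsExpFamily.ae_exists_abs_lpp_sub_gpp_le {W : ℤ × ℤ → Ω → ℝ}
    (h : IsExpFamily P (fun _ => 1) W) {ε : ℝ} (hε : 0 < ε) :
    ∀ᵐ ω ∂P, ∃ K : ℕ, ∀ m n : ℕ, K ≤ m + n →
      |lpp (fun z => W z ω) m n - gpp (m, n)| ≤ ε * ((m : ℝ) + n) := by
  set e := min ε 1 / 8 with he
  have he0 : 0 < e := by positivity
  have he1 : e ≤ 1 := by have := min_le_right ε 1; rw [he]; linarith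
  have heε : 8 * e ≤ ε := by have := min_le_left ε 1; rw [he]; linarith
  obtain ⟨C, c, hc, hlow⟩ := h.lpp_lower_tail he0 he1
  have hC0 := ae_exists_forall_notMem (P := P) hc
    (E := fun q => {ω | lpp (fun z => W z ω) q.1 q.2 ≤
      gpp ((q.1 : ℝ) + 1, (q.2 : ℝ) + 1) - e * ((q.1 : ℝ) + 1 + (q.2 + 1))})
    (fun m n => hlow m n _ rfl)
  have hC1 := ae_exists_forall_notMem (P := P) (C := 2) (c := (e / 32) ^ 2 * (e / 8) ^ 2 / 4)
    (by positivity)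
    (E := fun q => {ω | gpp ((q.1 : ℝ) + 1, (q.2 : ℝ) + 1) + e * ((q.1 : ℝ) + 1 + (q.2 + 1)) ≤
      lpp (fun z => W z ω) q.1 q.2})
    (fun m n => h.lpp_upper_tail he0 he1 m n le_rfl)
  filter_upwards [hC0, hC1] with ω h0 h1
  obtain ⟨K0, h0⟩ := h0
  obtain ⟨K1, h1⟩ := h1
  -- Beyond this threshold the additive constants, which come from comparing `(m + 1, n + 1)` with
  -- `(m, n)`, are at most `e * (m + n)`.
  obtain ⟨K2, hK2⟩ := exists_nat_ge ((2 * e + 4 + 4 / e) / e)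
  refine ⟨max K2 (max K0 K1), fun m n hmn => ?_⟩
  have a0 := h0 m n (by omega)
  have a1 := h1 m n (by omega)
  simp only [not_le] at a0 a1
  have hm0 : (0 : ℝ) ≤ m := Nat.cast_nonneg m
  have hn0 : (0 : ℝ) ≤ n := Nat.cast_nonneg n
  have hS : 2 * e + 4 + 4 / e ≤ e * ((m : ℝ) + n) := by
    have : (K2 : ℝ) ≤ (m : ℝ) + n := by exact_mod_cast (le_max_left _ _).trans hmn
    have := hK2.trans this
    rw [div_le_iff₀ he0] at this
    linarith
  have g1 := gpp_mono (x := (m : ℝ)) (y := n) (by linarith : (m : ℝ) ≤ m + 1)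
    (by linarith : (n : ℝ) ≤ n + 1)
  have g2 := gpp_add_one_le hm0 hn0 he0
  have g3 := gpp_le_two_mul hm0 hn0
  have g4 : 8 * e * ((m : ℝ) + n) ≤ ε * ((m : ℝ) + n) := by gcongr
  have g5 : e * gpp ((m : ℝ), n) ≤ e * (2 * ((m : ℝ) + n)) := by gcongr
  rw [abs_le]
  have : 0 ≤ e * ((m : ℝ) + n) := by positivity
  constructor <;> nlinarith

end

/-! ### From the uniform law to the shape theorem -/

theorem gpp_smul {c : ℝ} (hc : 0 ≤ c) (ζ : ℝ × ℝ) : gpp (c • ζ) = c * gpp ζ := by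
  simp only [gpp, Prod.smul_fst, Prod.smul_snd, smul_eq_mul, Real.sqrt_mul hc, ← mul_add, mul_pow,
    Real.sq_sqrt hc]

theorem floorPt_eq {ζ : ℝ × ℝ} (h1 : 0 ≤ ζ.1) (h2 : 0 ≤ ζ.2) :
    floorPt ζ = ((⌊ζ.1⌋₊ : ℤ), (⌊ζ.2⌋₊ : ℤ)) := by
  rw [floorPt, Int.natCast_floor_eq_floor h1, Int.natCast_floor_eq_floor h2]

theorem gpp_le_one_add_mul_gpp_floor_add {ζ : ℝ × ℝ} {e : ℝ} (he : 0 < e) :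
    gpp ζ ≤ (1 + e) * gpp ((⌊ζ.1⌋₊ : ℝ), (⌊ζ.2⌋₊ : ℝ)) + (4 + 4 / e) :=
  (gpp_mono (x := ζ.1) (y := ζ.2) (Nat.lt_floor_add_one _).le (Nat.lt_floor_add_one _).le).trans
    (gpp_add_one_le (Nat.cast_nonneg _) (Nat.cast_nonneg _) he)

theorem mem_smul_limitShape {c : ℝ} (hc : 0 < c) {ζ : ℝ × ℝ} (h1 : 0 ≤ ζ.1) (h2 : 0 ≤ ζ.2)
    (h : gpp ζ ≤ c) : ζ ∈ c • limitShape := by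
  refine ⟨c⁻¹ • ζ, ⟨?_, ?_, ?_⟩, smul_inv_smul₀ hc.ne' ζ⟩
  · exact mul_nonneg (by positivity) h1
  · exact mul_nonneg (by positivity) h2
  · rw [gpp_smul (by positivity), inv_mul_le_iff₀ hc, mul_one]; exact h

/-- The shape theorem, deterministically from a uniform estimate. -/
theorem shape_of_uniform {w : ℤ × ℤ → ℝ} (hw : ∀ z, 0 ≤ w z) {ε e t : ℝ} {k : ℕ} (hε : 0 < ε)
    (he : e = min ε 1 / 6)
    (hk : ∀ m n : ℕ, k ≤ m + n → |lpp w m n - gpp (m, n)| ≤ e * ((m : ℝ) + n))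
    (ht1 : lpp w k k ≤ t) (ht2 : (1 + e) * (2 * k) + (4 + 4 / e) ≤ t)
    (ht3 : (4 + 4 / e) * 2 / ε ≤ t) :
    (ε ≤ 1 → (t * (1 - ε)) • limitShape ⊆ cluster w t) ∧
      cluster w t ⊆ (t * (1 + ε)) • limitShape := by
  have he0 : 0 < e := by rw [he]; positivity
  have heε : 6 * e ≤ ε := by have := min_le_left ε 1; rw [he]; linarith
  have he1 : 6 * e ≤ 1 := by have := min_le_right ε 1; rw [he]; linarith
  have ht0 : 0 < t := lt_of_lt_of_le (by positivity) ht2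
  -- The uniform estimate says nothing near the origin; there monotonicity bounds every value by the
  -- one at `(k, k)`.
  have hsmall : ∀ m n : ℕ, m + n < k → lpp w m n ≤ t := fun m n h =>
    (lpp_mono hw (by omega) (by omega)).trans ht1
  constructor
  · rintro hε1 _ ⟨y, ⟨y1, y2, hy⟩, rfl⟩
    have hc : 0 ≤ t * (1 - ε) := mul_nonneg ht0.le (by linarith)
    set ζ := (t * (1 - ε)) • y with hζ
    have z1 : 0 ≤ ζ.1 := mul_nonneg hc y1
    have z2 : 0 ≤ ζ.2 := mul_nonneg hc y2
    have hg : gpp ζ ≤ t * (1 - ε) := by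
      rw [hζ, gpp_smul hc]; exact mul_le_of_le_one_right hc hy
    refine ⟨z1, z2, ?_⟩
    rw [floorPt_eq z1 z2, lastPassage_eq_lpp]
    rcases lt_or_ge (⌊ζ.1⌋₊ + ⌊ζ.2⌋₊) k with h | h
    · exact hsmall _ _ h
    · have h1 := (abs_le.1 (hk _ _ h)).2
      have h2 := add_le_gpp (x := (⌊ζ.1⌋₊ : ℝ)) (y := (⌊ζ.2⌋₊ : ℝ)) (Nat.cast_nonneg _)
        (Nat.cast_nonneg _)
      have h3 := gpp_mono (Nat.floor_le z1) (Nat.floor_le z2)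
      have h4 : gpp ((⌊ζ.1⌋₊ : ℝ), (⌊ζ.2⌋₊ : ℝ)) ≤ t * (1 - ε) := h3.trans hg
      -- Since `|x|₁ ≤ gpp x`, the error is relative, and `(1 - ε) * (1 + ε) ≤ 1` closes the
      -- estimate.
      have h5 : e * ((⌊ζ.1⌋₊ : ℝ) + ⌊ζ.2⌋₊) ≤ ε * (t * (1 - ε)) := by
        gcongr
        · linarith
        · exact h2.trans h4
      nlinarith [mul_pos hε (mul_pos hε ht0)]
  · rintro ζ ⟨z1, z2, hζ⟩
    rw [floorPt_eq z1 z2, lastPassage_eq_lpp] at hζ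
    refine mem_smul_limitShape (by positivity) z1 z2 ?_
    have hup := gpp_le_one_add_mul_gpp_floor_add (ζ := ζ) he0
    rcases lt_or_ge (⌊ζ.1⌋₊ + ⌊ζ.2⌋₊) k with h | h
    · have h1 := gpp_le_two_mul (x := (⌊ζ.1⌋₊ : ℝ)) (y := (⌊ζ.2⌋₊ : ℝ)) (Nat.cast_nonneg _)
        (Nat.cast_nonneg _)
      have h2 : (⌊ζ.1⌋₊ : ℝ) + ⌊ζ.2⌋₊ ≤ k := by exact_mod_cast h.le
      have h3 : (1 + e) * gpp ((⌊ζ.1⌋₊ : ℝ), (⌊ζ.2⌋₊ : ℝ)) ≤ (1 + e) * (2 * k) := by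
        gcongr; linarith
      nlinarith [mul_pos hε ht0]
    · have h1 := (abs_le.1 (hk _ _ h)).1
      have h2 := add_le_gpp (x := (⌊ζ.1⌋₊ : ℝ)) (y := (⌊ζ.2⌋₊ : ℝ)) (Nat.cast_nonneg _)
        (Nat.cast_nonneg _)
      set g := gpp ((⌊ζ.1⌋₊ : ℝ), (⌊ζ.2⌋₊ : ℝ)) with hg
      have h3 : e * ((⌊ζ.1⌋₊ : ℝ) + ⌊ζ.2⌋₊) ≤ e * g := by gcongr
      have h4 : (1 - e) * g ≤ t := by linarith
      -- Half of the margin `ε` pays for the relative errors; the other half pays for the constant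
      -- `4 + 4 / e`, by `ht3`.
      have h5 : (1 + e) ≤ (1 + ε / 2) * (1 - e) := by nlinarith
      have hg0 : 0 ≤ g := gpp_nonneg _
      have h6 : (1 + e) * g ≤ (1 + ε / 2) * t :=
        calc (1 + e) * g ≤ (1 + ε / 2) * (1 - e) * g := by gcongr
          _ = (1 + ε / 2) * ((1 - e) * g) := by ring
          _ ≤ _ := by gcongr
      rw [div_le_iff₀ hε] at ht3
      linarith

/-! ### Measurable thresholds and the law of large numbers -/

section
variable {Ω : Type*} [MeasurableSpace Ω] {P : Measure Ω}

/-- If almost surely only finitely many of the events `D n` occur, then a random variable bounds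
the indices of those that occur. -/
theorem exists_measurable_forall_notMem {D : ℕ → Set Ω} (hD : ∀ n, MeasurableSet (D n))
    (h : ∀ᵐ ω ∂P, ∃ K : ℕ, ∀ n, K ≤ n → ω ∉ D n) :
    ∃ K : Ω → ℝ, Measurable K ∧ ∀ᵐ ω ∂P, ∀ n : ℕ, K ω ≤ n → ω ∉ D n := by
  -- The sum of `n + 1` over the events that occur is measurable and exceeds each of their indices.
  -- It is infinite only on a null set, where the value 0 of `toReal` does no harm.
  let F : Ω → ENNReal := fun ω => ∑' n : ℕ, (D n).indicator (fun _ => (n + 1 : ENNReal)) ω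
  have hF : Measurable F :=
    Measurable.tsum fun n => measurable_const.indicator (hD n)
  refine ⟨fun ω => (F ω).toReal, hF.ennreal_toReal, ?_⟩
  filter_upwards [h] with ω hω n hn hmem
  obtain ⟨K, hK⟩ := hω
  have hfin : F ω ≠ ⊤ := by
    have : F ω = ∑ n ∈ Finset.range K, (D n).indicator (fun _ => (n + 1 : ENNReal)) ω := by
      refine tsum_eq_sum fun n hn => ?_
      rw [Finset.mem_range, not_lt] at hn
      simp [hK n hn]
    rw [this]
    refine ENNReal.sum_ne_top.2 fun n _ => ?_
    by_cases hn : ω ∈ D n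
    · simp [hn]
    · simp [hn]
  have hle : (n + 1 : ENNReal) ≤ F ω := by
    refine le_trans (le_of_eq ?_) (ENNReal.le_tsum n)
    simp [hmem]
  have := ENNReal.toReal_mono hfin hle
  rw [ENNReal.toReal_add (by simp) (by simp)] at this
  simp at this
  linarith

variable [IsProbabilityMeasure P] {W : ℤ × ℤ → Ω → ℝ}

/-- The uniform law of large numbers with a measurable threshold. -/
theorem IsExpFamily.exists_measurable_threshold (h : IsExpFamily P (fun _ => 1) W) {ε : ℝ}
    (hε : 0 < ε) :
    ∃ K : Ω → ℝ, Measurable K ∧ ∀ᵐ ω ∂P, ∀ m n : ℕ, K ω ≤ ((m + n : ℕ) : ℝ) →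
      |lpp (fun z => W z ω) m n - gpp (m, n)| ≤ ε * ((m : ℝ) + n) := by
  have hm : ∀ s : ℕ, MeasurableSet (⋃ (m : ℕ) (n : ℕ) (_ : m + n = s),
      {ω | ε * ((m : ℝ) + n) < |lpp (fun z => W z ω) m n - gpp (m, n)|}) := fun s =>
    MeasurableSet.iUnion fun m => MeasurableSet.iUnion fun n => MeasurableSet.iUnion fun _ =>
      measurableSet_lt measurable_const
        (((measurable_lpp h.measurable m n).sub_const _).abs)
  obtain ⟨K, hKm, hK⟩ := exists_measurable_forall_notMem (P := P) hm (by
    filter_upwards [h.ae_exists_abs_lpp_sub_gpp_le hε] with ω hω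
    obtain ⟨K, hK⟩ := hω
    refine ⟨K, fun s hs hmem => ?_⟩
    simp only [Set.mem_iUnion] at hmem
    obtain ⟨m, n, rfl, hmem⟩ := hmem
    exact not_lt.2 (hK m n hs) hmem)
  refine ⟨K, hKm, ?_⟩
  filter_upwards [hK] with ω hω m n hmn
  by_contra hcon
  refine hω (m + n) hmn ?_
  simp only [Set.mem_iUnion]
  exact ⟨m, n, rfl, not_le.1 hcon⟩

theorem IsExpFamily.tendsto_lastPassage (h : IsExpFamily P (fun _ => 1) W) {ξ : ℝ × ℝ}
    (h1 : 0 ≤ ξ.1) (h2 : 0 ≤ ξ.2) :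
    ∀ᵐ ω ∂P, Tendsto (fun N : ℕ => (N : ℝ)⁻¹ * lastPassage (fun x => W x ω) 0
      (floorPt ((N : ℝ) • ξ))) atTop (𝓝 (gpp ξ)) := by
  have hall : ∀ᵐ ω ∂P, ∀ q : ℕ, ∃ K : ℕ, ∀ m n : ℕ, K ≤ m + n →
      |lpp (fun z => W z ω) m n - gpp (m, n)| ≤ 1 / ((q : ℝ) + 1) * ((m : ℝ) + n) :=
    ae_all_iff.2 fun q => h.ae_exists_abs_lpp_sub_gpp_le (by positivity)
  filter_upwards [hall] with ω hω
  have hfl : ∀ N : ℕ, floorPt ((N : ℝ) • ξ) = ((⌊ξ.1 * N⌋₊ : ℤ), (⌊ξ.2 * N⌋₊ : ℤ)) := by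
    intro N
    rw [floorPt_eq (mul_nonneg (Nat.cast_nonneg N) h1) (mul_nonneg (Nat.cast_nonneg N) h2)]
    simp [mul_comm]
  simp only [hfl, lastPassage_eq_lpp]
  have t1 : Tendsto (fun N : ℕ => (⌊ξ.1 * (N : ℝ)⌋₊ : ℝ) / N) atTop (𝓝 ξ.1) :=
    (tendsto_nat_floor_mul_div_atTop h1).comp tendsto_natCast_atTop_atTop
  have t2 : Tendsto (fun N : ℕ => (⌊ξ.2 * (N : ℝ)⌋₊ : ℝ) / N) atTop (𝓝 ξ.2) :=
    (tendsto_nat_floor_mul_div_atTop h2).comp tendsto_natCast_atTop_atTop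
  have hcont : Continuous gpp := by unfold gpp; fun_prop
  have t3 : Tendsto (fun N : ℕ => (N : ℝ)⁻¹ * gpp ((⌊ξ.1 * (N : ℝ)⌋₊ : ℝ), (⌊ξ.2 * (N : ℝ)⌋₊ : ℝ)))
      atTop (𝓝 (gpp ξ)) := by
    have := (hcont.tendsto (ξ.1, ξ.2)).comp (t1.prodMk_nhds t2)
    refine this.congr fun N => ?_
    rw [← gpp_smul (by positivity)]
    simp [div_eq_inv_mul]
  have t4 : Tendsto (fun N : ℕ => (N : ℝ)⁻¹ *
      (lpp (fun x => W x ω) ⌊ξ.1 * (N : ℝ)⌋₊ ⌊ξ.2 * (N : ℝ)⌋₊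
      - gpp ((⌊ξ.1 * (N : ℝ)⌋₊ : ℝ), (⌊ξ.2 * (N : ℝ)⌋₊ : ℝ)))) atTop (𝓝 0) := by
    -- For `ξ = 0` the lattice point stays at the origin and never passes the threshold, but a fixed
    -- value divided by `N` tends to 0.
    rcases (add_nonneg h1 h2).eq_or_lt with h0 | h0
    · have e1 : ξ.1 = 0 := by linarith
      have e2 : ξ.2 = 0 := by linarith
      simp only [e1, e2, zero_mul, Nat.floor_zero]
      have := (tendsto_inv_atTop_zero.comp (tendsto_natCast_atTop_atTop (R := ℝ))).mul_const
        (lpp (fun x => W x ω) 0 0 - gpp (((0 : ℕ) : ℝ), ((0 : ℕ) : ℝ)))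
      simpa using this
    · have hsum : Tendsto (fun N : ℕ => ⌊ξ.1 * (N : ℝ)⌋₊ + ⌊ξ.2 * (N : ℝ)⌋₊) atTop atTop := by
        have key : ∀ a : ℝ, 0 < a → Tendsto (fun N : ℕ => ⌊a * (N : ℝ)⌋₊) atTop atTop := fun a ha =>
          tendsto_nat_floor_atTop.comp (tendsto_natCast_atTop_atTop.const_mul_atTop ha)
        rcases h1.eq_or_lt with h3 | h3
        · exact tendsto_atTop_mono (fun N => Nat.le_add_left _ _) (key ξ.2 (by linarith))
        · exact tendsto_atTop_mono (fun N => Nat.le_add_right _ _) (key ξ.1 h3)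
      rw [Metric.tendsto_nhds]
      intro ε hε
      obtain ⟨q, hq⟩ := exists_nat_gt ((ξ.1 + ξ.2) / ε)
      obtain ⟨K, hK⟩ := hω q
      filter_upwards [hsum.eventually_ge_atTop K, eventually_gt_atTop 0] with N hN hN0
      have hN' : (0 : ℝ) < N := Nat.cast_pos.2 hN0
      have b1 := Nat.floor_le (mul_nonneg h1 hN'.le)
      have b2 := Nat.floor_le (mul_nonneg h2 hN'.le)
      rw [Real.dist_eq, sub_zero, abs_mul, abs_of_nonneg (by positivity), inv_mul_lt_iff₀ hN']
      refine (hK _ _ hN).trans_lt ?_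
      rw [div_lt_iff₀ hε] at hq
      rw [one_div, inv_mul_lt_iff₀ (by positivity)]
      have : (⌊ξ.1 * (N : ℝ)⌋₊ : ℝ) + ⌊ξ.2 * (N : ℝ)⌋₊ ≤ (ξ.1 + ξ.2) * N := by linarith
      nlinarith [mul_pos hN' hε]
  have := t3.add t4
  rw [add_zero] at this
  refine this.congr fun N => ?_
  ring

theorem IsExpFamily.exists_measurable_shape_threshold (h : IsExpFamily P (fun _ => 1) W) {ε : ℝ}
    (hε : 0 < ε) :
    ∃ T : Ω → ℝ, Measurable T ∧ ∀ᵐ ω ∂P, ∀ t : ℝ, T ω ≤ t →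
      (ε ≤ 1 → (t * (1 - ε)) • limitShape ⊆ cluster (fun x => W x ω) t) ∧
      cluster (fun x => W x ω) t ⊆ (t * (1 + ε)) • limitShape := by
  set e := min ε 1 / 6 with he
  obtain ⟨K, hKm, hK⟩ := h.exists_measurable_threshold (ε := e) (by positivity)
  have hk : Measurable fun ω => ⌈K ω⌉₊ := hKm.nat_ceil
  -- The last-passage value at a random site is measurable because the site takes countably many
  -- values.
  have hG : Measurable fun ω => lpp (fun z => W z ω) ⌈K ω⌉₊ ⌈K ω⌉₊ :=
    (measurable_from_prod_countable_left (f := fun q : Ω × ℕ => lpp (fun z => W z q.1) q.2 q.2)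
      fun k => measurable_lpp h.measurable k k).comp (measurable_id.prodMk hk)
  refine ⟨fun ω => max (lpp (fun z => W z ω) ⌈K ω⌉₊ ⌈K ω⌉₊)
    (max ((1 + e) * (2 * (⌈K ω⌉₊ : ℝ)) + (4 + 4 / e)) ((4 + 4 / e) * 2 / ε)), ?_, ?_⟩
  · have hk' : Measurable fun ω => (⌈K ω⌉₊ : ℝ) := measurable_from_nat.comp hk
    exact hG.max ((((hk'.const_mul 2).const_mul _).add_const _).max measurable_const)
  · filter_upwards [hK, h.ae_nonneg] with ω hω hW t ht
    have ht' := max_le_iff.1 ((le_max_right _ _).trans ht)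
    refine shape_of_uniform hW hε he (fun m n hmn => hω m n ?_) ((le_max_left _ _).trans ht)
      ht'.1 ht'.2
    exact (Nat.le_ceil _).trans (Nat.cast_le.2 hmn)

end

end CornerGrowth

theorem theoremt {Ω : Type*} [MeasurableSpace Ω] (P : Measure Ω) [IsProbabilityMeasure P]
    (W : ℤ × ℤ → Ω → ℝ)
    (hmeas : ∀ x, Measurable (W x))
    (hlaw : ∀ x, HasLaw (W x) (expMeasure 1) P)
    (hindep : iIndepFun W P) :
    -- `g_pp` is the almost sure limit of the scaled last-passage values
    (∀ ξ : ℝ × ℝ, 0 ≤ ξ.1 → 0 ≤ ξ.2 → ∀ᵐ ω ∂P,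
      Tendsto (fun N : ℕ =>
          (N : ℝ)⁻¹ * CornerGrowth.lastPassage (fun x => W x ω) 0
            (CornerGrowth.floorPt ((N : ℝ) • ξ)))
        atTop (𝓝 (CornerGrowth.gpp ξ))) ∧
    -- uniform law of large numbers
    (∀ ε : ℝ, 0 < ε → ∃ K : Ω → ℝ, Measurable K ∧ ∀ᵐ ω ∂P,
      ∀ x : ℤ × ℤ, 0 ≤ x.1 → 0 ≤ x.2 → K ω ≤ (CornerGrowth.l1 x : ℝ) →
        |CornerGrowth.lastPassage (fun z => W z ω) 0 x
            - CornerGrowth.gpp ((x.1 : ℝ), (x.2 : ℝ))| ≤ ε * (CornerGrowth.l1 x : ℝ)) ∧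
    -- shape theorem
    (∀ ε : ℝ, 0 < ε → ∃ T : Ω → ℝ, Measurable T ∧ ∀ᵐ ω ∂P, ∀ t : ℝ, T ω ≤ t →
      (ε ≤ 1 → (t * (1 - ε)) • CornerGrowth.limitShape
          ⊆ CornerGrowth.cluster (fun x => W x ω) t) ∧
      CornerGrowth.cluster (fun x => W x ω) t
          ⊆ (t * (1 + ε)) • CornerGrowth.limitShape) := by
  have h : CornerGrowth.IsExpFamily P (fun _ => 1) W := ⟨hmeas, hlaw, hindep⟩
  refine ⟨fun ξ h1 h2 => h.tendsto_lastPassage h1 h2, fun ε hε => ?_,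
    fun ε hε => h.exists_measurable_shape_threshold hε⟩
  obtain ⟨K, hKm, hK⟩ := h.exists_measurable_threshold hε
  refine ⟨K, hKm, ?_⟩
  filter_upwards [hK] with ω hω x h1 h2 hx
  obtain ⟨x1, x2⟩ := x
  lift x1 to ℕ using h1
  lift x2 to ℕ using h2
  have hl : CornerGrowth.l1 ((x1 : ℤ), (x2 : ℤ)) = x1 + x2 := by simp [CornerGrowth.l1]
  rw [hl] at hx ⊢
  rw [CornerGrowth.lastPassage_eq_lpp]
  simpa using hω x1 x2 hx
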